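/- Let $r,g\ge 0$ be integers with $r+g>0$, let $n\ge 1$, and let $$M_{g,r,n}=\{(A_1,A_1^\ast,\dots,A_g,A_g^\ast,Z_1,\dots,Z_r)\mid A_i,A_i^\ast,Z_j\in \mathrm{GL}_n(\mathbb C)\},$$ a smooth affine complex variety on which $\mathrm{GL}_n(\mathbb C)$ acts by simultaneous conjugation. For a matrix variable $C$ let $\partial_C$ be the matrix of vector fields with entries $(\partial_C)_{kl}=\partial/\partial C_{lk}$, and put $(A_i^\ast)^\ast:=A_i$. Conventions. Wedge products are $u\wedge v=u\otimes v-v\otimes u$, and similarly $u\wedge v\wedge w$ is the sum over all permutations with signs; for matrices of vector fields, $\mathrm{tr}[D\wedge D']=\sum_{i,j}D_{ij}\wedge D'_{ji}$. For $\xi\in\mathfrak{gl}_n$, $\xi_M$ is the vector field whose value at $x$ is $\frac{d}{dt}\big|_{t=0}\exp(-t\xi)\cdot x$. With $(E_a)$, $(E^a)$ dual bases of $\mathfrak{gl}_n$ for the trace form, $\phi_M=\frac1{12}\sum_{a,b,c}\mathrm{tr}(E^a[E^b,E^c])\,(E_a)_M\wedge(E_b)_M\wedge(E_c)_M$. A bivector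 $P$ on $M_{g,r,n}$ is quasi-Poisson if it is $\mathrm{GL}_n$-invariant and its Schouten bracket satisfies $[P,P]=\phi_M$. A moment map for $P$ is a $\mathrm{GL}_n$-equivariant morphism $\Phi:M_{g,r,n}\to\mathrm{GL}_n$ (for conjugation on the target) such that $P^\sharp(d(F\circ\Phi))=(\mathcal D(F)\circ\Phi)_M$ for every function $F$ on $\mathrm{GL}_n$, where $P^\sharp(\alpha)(\beta)=P(\alpha,\beta)$ and $\mathcal D(F)(h)=\frac12\sum_a\frac{d}{dt}\big|_{t=0}\big(F(he^{tE_a})+F(e^{tE_a}h)\big)E^a$. A family of bivectors $(P_j)_{j\in J}$ is a Hamiltonian quasi-Poisson pencil centered at a quasi-Poisson bivector $P_0$ with moment map $\Phi$ if every $P_0+\sum_{j\in J_0}c_jP_j$ ($J_0\subset J$ finite, $c_j\in\mathbb C$) is quasi-Poisson with moment map $\Phi$; these bivectors are the members of the pencil. Its order is the largest $m\geq 0$ for which there are $j_1,\dots,j_m\in J$ and a point $x$ such that $P_{j_1,x},\dots,P_{j_m,x}$ are linearly independent (so the order is $0$ if $J=\emptyset$). Theorem. The bivectors $$\mathrm{tr}[A_i^\ast\partial_{A_i^\ast}-A_i\partial_{A_i}]\wedge\mathrm{tr}[A_k^\ast\partial_{A_k^\ast}-A_k\partial_{A_k}],\qquad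 1\le i<k\le g,$$ form a Hamiltonian quasi-Poisson pencil on $M_{g,r,n}$ of order $g(g-1)/2$, centered at the quasi-Poisson bivector $$\begin{aligned}P_{\mathrm{char}}:=\;&\tfrac12\sum_{1\le i\le g}\mathrm{tr}\big[A_i^\ast A_i\,\partial_{A_i}\wedge\partial_{A_i^\ast}-A_iA_i^\ast\,\partial_{A_i^\ast}\wedge\partial_{A_i}\big]+\tfrac12\sum_{1\le j\le r}\mathrm{tr}\big[Z_j^2\,\partial_{Z_j}\wedge\partial_{Z_j}\big]\\&-\tfrac12\sum_{1\le i\le g}\mathrm{tr}\big[(\partial_{A_i^\ast}A_i^\ast-A_i\partial_{A_i})\wedge(\partial_{A_i}A_i-A_i^\ast\partial_{A_i^\ast})\big]\\&-\tfrac12\sum_{1\le i<k\le g}\ \sum_{\substack{C_i\in\{A_i,A_i^\ast\}\\C_k\in\{A_k,A_k^\ast\}}}\mathrm{tr}\big[(\partial_{C_i^\ast}C_i^\ast-C_i\partial_{C_i})\wedge(\partial_{C_k^\ast}C_k^\ast-C_k\partial_{C_k})\big]\\&-\tfrac12\sum_{\substack{1\le i\le g\\C_i\in\{A_i,A_i^\ast\}}}\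 \sum_{1\le j\le r}\mathrm{tr}\big[(\partial_{C_i^\ast}C_i^\ast-C_i\partial_{C_i})\wedge(\partial_{Z_j}Z_j-Z_j\partial_{Z_j})\big]\\&-\tfrac12\sum_{1\le j<k\le r}\mathrm{tr}\big[(\partial_{Z_j}Z_j-Z_j\partial_{Z_j})\wedge(\partial_{Z_k}Z_k-Z_k\partial_{Z_k})\big],\end{aligned}$$ with moment map $$\Phi(A_i,A_i^\ast,Z_j)=\prod_{1\le i\le g}A_iA_i^\ast A_i^{-1}(A_i^\ast)^{-1}\;Z_1\cdots Z_r$$ (factors in increasing order of the index). The members of the pencil are exactly the bivectors $P_{\mathrm{char}}+\psi_{\underline z}$ with $\underline z=(z_{i,k})_{i<k}$, $z_{i,k}\in\mathbb C$, and $$\psi_{\underline z}=\sum_{1\le i<k\le g}z_{i,k}\,\mathrm{tr}[A_i^\ast\partial_{A_i^\ast}-A_i\partial_{A_i}]\wedge\mathrm{tr}[A_k^\ast\partial_{A_k^\ast}-A_k\partial_{A_k}].$$ In particular the added terms $\psi_{\underline z}$ involve only the $A_i,A_i^\ast$. -/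

import Mathlib

open scoped Matrix.Norms.Elementwise

noncomputable section

namespace CharVar

/-! ### Multivectors on a finite-dimensional complex vector space

The tangent space at a point of an open subset of `V` is `V`. Contravariant 2-tensors on `V` are
written as bilinear forms on the dual, through `⟨u ⊗ v, α ⊗ β⟩ = α u * β v`; the elements of
`⋀² V` are the alternating ones. -/

section Multivectors

variable (V : Type*) [NormedAddCommGroup V] [NormedSpace ℂ V]

/-- Bilinear forms on the space of covectors of `V`. -/
abbrev Tensor2 : Type _ := StrongDual ℂ V →ₗ[ℂ] StrongDual ℂ V →ₗ[ℂ] ℂ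

variable {V}

/-- Evaluation of covectors at a vector `u`. -/
def ev (u : V) : StrongDual ℂ V →ₗ[ℂ] ℂ where
  toFun α := α u
  map_add' _ _ := rfl
  map_smul' _ _ := rfl

/-- `u ∧ v = u ⊗ v - v ⊗ u`. -/
def wedge (u v : V) : Tensor2 V := (ev u).smulRight (ev v) - (ev v).smulRight (ev u)

theorem wedge_apply (u v : V) (α β : StrongDual ℂ V) :
    wedge u v α β = α u * β v - α v * β u := by
  simp [wedge, ev]

/-- The value of the trivector `u ∧ v ∧ w` on three covectors. -/
def wedge3 (u v w : V) (α β γ : StrongDual ℂ V) : ℂ :=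
  Matrix.det !![α u, β u, γ u; α v, β v, γ v; α w, β w, γ w]

/-- The Schouten-Nijenhuis bracket `[P, Q]` of two bivector fields at the point `x`, evaluated on
three covectors `α, β, γ` (equivalently, on the differentials of three linear functions). In terms
of the brackets `{f, g}_P = P(df, dg)` it is the cyclic sum of
`{f, {g, h}_Q}_P + {f, {g, h}_P}_Q`; this is the bracket that extends the Lie bracket of
vector fields, with `[X ∧ Y, X ∧ Y] = 2 [X, Y] ∧ X ∧ Y`. -/
def schouten (P Q : V → Tensor2 V) (x : V) (α β γ : StrongDual ℂ V) : ℂ :=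
  (P x α (fderiv ℂ (fun y => Q y β γ) x) + Q x α (fderiv ℂ (fun y => P y β γ) x)) +
  (P x β (fderiv ℂ (fun y => Q y γ α) x) + Q x β (fderiv ℂ (fun y => P y γ α) x)) +
  (P x γ (fderiv ℂ (fun y => Q y α β) x) + Q x γ (fderiv ℂ (fun y => P y α β) x))

end Multivectors

/-! ### The space of tuples -/

/-- Index set of the tuple: `inl (i, false)` is `A_i`, `inl (i, true)` is `A_i^*`,
and `inr j` is `Z_j`. -/
abbrev Gen (g r : ℕ) : Type := (Fin g × Bool) ⊕ Fin r

/-- Tuples of arbitrary `n × n` matrices. -/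
abbrev Rep (g r n : ℕ) : Type := Gen g r → Matrix (Fin n) (Fin n) ℂ

/-- The variety of tuples of invertible matrices, a Zariski open subset of the affine space
`Rep g r n`. -/
def variety (g r n : ℕ) : Set (Rep g r n) := {X | ∀ c, IsUnit (X c)}

variable {g r n : ℕ}

/-- The coordinate ring of the variety: the functions generated by the matrix entries and by the
inverses of the determinants. -/
def regularFunctions (g r n : ℕ) : Subalgebra ℂ (variety g r n → ℂ) :=
  Algebra.adjoin ℂ
    (Set.range (fun (p : Gen g r × Fin n × Fin n) (X : variety g r n) => X.1 p.1 p.2.1 p.2.2) ∪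
      Set.range (fun (c : Gen g r) (X : variety g r n) => ((X.1 c).det)⁻¹))

/-- `f` restricts to a regular function on the variety. -/
def IsRegular (f : Rep g r n → ℂ) : Prop :=
  (fun X : variety g r n => f X) ∈ regularFunctions g r n

/-- Simultaneous conjugation. -/
def act (h : GL (Fin n) ℂ) (X : Rep g r n) : Rep g r n :=
  fun c => (h : Matrix (Fin n) (Fin n) ℂ) * X c * ((h⁻¹ : GL (Fin n) ℂ) : Matrix _ _ ℂ)

/-- The vector field `ξ_M` of the infinitesimal action: its value at `X` is the derivative at
`t = 0` of `exp (-t ξ) X exp (t ξ)`, i.e. `[X_c, ξ]` in each component. -/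
def infAct (ξ : Matrix (Fin n) (Fin n) ℂ) (X : Rep g r n) : Rep g r n :=
  fun c => X c * ξ - ξ * X c

/-- The basis `E_a` of `𝔤𝔩_n`, `a = (i, j)`, consisting of elementary matrices. -/
def basisE (a : Fin n × Fin n) : Matrix (Fin n) (Fin n) ℂ := Matrix.single a.1 a.2 1

/-- The dual basis `E^a` for the trace form. -/
def dualE (a : Fin n × Fin n) : Matrix (Fin n) (Fin n) ℂ := Matrix.single a.2 a.1 1

/-- The trivector field `φ_M` induced by the Cartan trivector
`φ = 1/12 ∑ (E^a, [E^b, E^c]) E_a ∧ E_b ∧ E_c`. -/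
def cartanTrivector (X : Rep g r n) (α β γ : StrongDual ℂ (Rep g r n)) : ℂ :=
  (1 / 12) * ∑ a : Fin n × Fin n, ∑ b : Fin n × Fin n, ∑ c : Fin n × Fin n,
    (dualE a * (dualE b * dualE c - dualE c * dualE b)).trace *
      wedge3 (infAct (basisE a) X) (infAct (basisE b) X) (infAct (basisE c) X) α β γ

/-! ### Quasi-Poisson bivectors, moment maps and pencils -/

/-- Quasi-Poisson bivector fields on the variety of tuples (values outside of the variety are
irrelevant). -/
structure IsQuasiPoisson (P : Rep g r n → Tensor2 (Rep g r n)) : Prop where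
  alternating : ∀ X ∈ variety g r n, ∀ α, P X α α = 0
  regular : ∀ α β, IsRegular (fun X => P X α β)
  /-- `P` is invariant under pushforward by the action. -/
  invariant : ∀ h : GL (Fin n) ℂ, ∀ X ∈ variety g r n, ∀ α β,
    P (act h X) α β = P X (α.comp (fderiv ℂ (act h) X)) (β.comp (fderiv ℂ (act h) X))
  schouten_eq : ∀ X ∈ variety g r n, ∀ α β γ, schouten P P X α β γ = cartanTrivector X α β γ

/-- `𝒟(F) = 1/2 ∑ (E_a^L + E_a^R)(F) E^a`, where `ξ^L` and `ξ^R` are the vector fields with values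
`p ξ` and `ξ p` at `p`. -/
def operD (F : Matrix (Fin n) (Fin n) ℂ → ℂ) (p : Matrix (Fin n) (Fin n) ℂ) :
    Matrix (Fin n) (Fin n) ℂ :=
  (1 / 2 : ℂ) • ∑ a : Fin n × Fin n,
    (fderiv ℂ F p (p * basisE a) + fderiv ℂ F p (basisE a * p)) • dualE a

/-- `Φ` restricts to an equivariant morphism from the variety of tuples to `GL_n` which is a moment
map for `P`: for every function `F` on an open neighbourhood of `Φ X` one has
`P^♯(d(F ∘ Φ)) = (𝒟(F) ∘ Φ)_M` at `X`. -/
structure IsMomentMap (P : Rep g r n → Tensor2 (Rep g r n))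
    (Φ : Rep g r n → Matrix (Fin n) (Fin n) ℂ) : Prop where
  isUnit : ∀ X ∈ variety g r n, IsUnit (Φ X)
  regular : ∀ i j, IsRegular (fun X => Φ X i j)
  regular_inv_det : IsRegular (fun X => ((Φ X).det)⁻¹)
  equivariant : ∀ h : GL (Fin n) ℂ, ∀ X ∈ variety g r n,
    Φ (act h X) = (h : Matrix (Fin n) (Fin n) ℂ) * Φ X * ((h⁻¹ : GL (Fin n) ℂ) : Matrix _ _ ℂ)
  moment : ∀ X ∈ variety g r n, ∀ F : Matrix (Fin n) (Fin n) ℂ → ℂ,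
    DifferentiableAt ℂ F (Φ X) → ∀ β : StrongDual ℂ (Rep g r n),
      P X (fderiv ℂ (fun Y => F (Φ Y)) X) β = β (infAct (operD F (Φ X)) X)

/-- The bivector fields `P₀ + ∑_{j ∈ J₀} c_j P_j`, for `J₀` finite. -/
def pencilMembers {J : Type*} (P₀ : Rep g r n → Tensor2 (Rep g r n))
    (P : J → Rep g r n → Tensor2 (Rep g r n)) : Set (Rep g r n → Tensor2 (Rep g r n)) :=
  {Q | ∃ (J₀ : Finset J) (c : J → ℂ), Q = P₀ + ∑ j ∈ J₀, c j • P j}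

/-- The family `P` is a Hamiltonian quasi-Poisson pencil centered at `P₀` with moment map `Φ`. -/
structure IsHamiltonianPencil {J : Type*} (P₀ : Rep g r n → Tensor2 (Rep g r n))
    (P : J → Rep g r n → Tensor2 (Rep g r n)) (Φ : Rep g r n → Matrix (Fin n) (Fin n) ℂ) :
    Prop where
  center : IsQuasiPoisson P₀
  quasiPoisson : ∀ Q ∈ pencilMembers P₀ P, IsQuasiPoisson Q
  moment : ∀ Q ∈ pencilMembers P₀ P, IsMomentMap Q Φ

/-- The order of a pencil is `m`: this is the largest number of members of the family that are
linearly independent at some point (zero for an empty family). -/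
def HasOrder {J : Type*} (P : J → Rep g r n → Tensor2 (Rep g r n)) (m : ℕ) : Prop :=
  IsGreatest {k : ℕ | ∃ j : Fin k → J, ∃ X ∈ variety g r n,
    LinearIndependent ℂ (fun s => P (j s) X)} m

/-! ### The explicit pencil -/

/-- Matrices whose entries are tangent vectors. -/
abbrev TMat (g r n : ℕ) : Type := Matrix (Fin n) (Fin n) (Rep g r n)

/-- Product of a scalar matrix with a matrix of tangent vectors. -/
def lmul (B : Matrix (Fin n) (Fin n) ℂ) (D : TMat g r n) : TMat g r n :=
  Matrix.of fun i k => ∑ j, B i j • D j k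

/-- Product of a matrix of tangent vectors with a scalar matrix. -/
def rmul (D : TMat g r n) (B : Matrix (Fin n) (Fin n) ℂ) : TMat g r n :=
  Matrix.of fun i k => ∑ j, B j k • D i j

/-- `tr [D ∧ D'] = ∑ D_ij ∧ D'_ji`. -/
def trWedge (D D' : TMat g r n) : Tensor2 (Rep g r n) := ∑ i, ∑ j, wedge (D i j) (D' j i)

/-- The matrix `∂_c` of vector fields, with `(k, l)` entry `∂ / ∂ (X_c)_lk`. -/
def del (c : Gen g r) : TMat g r n :=
  Matrix.of fun k l => Pi.single c (Matrix.single l k 1)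

/-- Index of `A_i` (for `b = false`) or `A_i^*` (for `b = true`); `arrow i (!b)` is the index of
the starred variable. -/
abbrev arrow (i : Fin g) (b : Bool) : Gen g r := Sum.inl (i, b)

/-- Index of `Z_j`. -/
abbrev loop (j : Fin r) : Gen g r := Sum.inr j

/-- `∂_{C^*} C^* - C ∂_C` at `X`, for `C = A_i` or `C = A_i^*`. -/
def vArrow (X : Rep g r n) (i : Fin g) (b : Bool) : TMat g r n :=
  rmul (del (arrow i (!b))) (X (arrow i (!b))) - lmul (X (arrow i b)) (del (arrow i b))

/-- `∂_{Z_j} Z_j - Z_j ∂_{Z_j}` at `X`. -/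
def vLoop (X : Rep g r n) (j : Fin r) : TMat g r n :=
  rmul (del (loop j)) (X (loop j)) - lmul (X (loop j)) (del (loop j))

/-- The bivector field `P_char`. -/
def Pchar (X : Rep g r n) : Tensor2 (Rep g r n) :=
  (1 / 2 : ℂ) • ∑ i : Fin g,
      (trWedge (lmul (X (arrow i true) * X (arrow i false)) (del (arrow i false)))
          (del (arrow i true))
        - trWedge (lmul (X (arrow i false) * X (arrow i true)) (del (arrow i true)))
          (del (arrow i false)))
    + (1 / 2 : ℂ) • ∑ j : Fin r, trWedge (lmul (X (loop j) ^ 2) (del (loop j))) (del (loop j))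
    - (1 / 2 : ℂ) • ∑ i : Fin g, trWedge (vArrow X i false) (vArrow X i true)
    - (1 / 2 : ℂ) • ∑ i : Fin g, ∑ k ∈ Finset.Ioi i, ∑ b : Bool, ∑ b' : Bool,
        trWedge (vArrow X i b) (vArrow X k b')
    - (1 / 2 : ℂ) • ∑ i : Fin g, ∑ b : Bool, ∑ j : Fin r, trWedge (vArrow X i b) (vLoop X j)
    - (1 / 2 : ℂ) • ∑ j : Fin r, ∑ k ∈ Finset.Ioi j, trWedge (vLoop X j) (vLoop X k)

/-- The map `∏ A_i A_i^* A_i⁻¹ (A_i^*)⁻¹ Z_1 ⋯ Z_r`, with factors in increasing order. -/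
def momentMap (X : Rep g r n) : Matrix (Fin n) (Fin n) ℂ :=
  (List.ofFn fun i : Fin g =>
      X (arrow i false) * X (arrow i true) * (X (arrow i false))⁻¹ * (X (arrow i true))⁻¹).prod
    * (List.ofFn fun j : Fin r => X (loop j)).prod

/-- The vector field `tr [A_i^* ∂_{A_i^*} - A_i ∂_{A_i}]`. -/
def euler (i : Fin g) (X : Rep g r n) : Rep g r n :=
  Matrix.trace (lmul (X (arrow i true)) (del (arrow i true))
    - lmul (X (arrow i false)) (del (arrow i false)))

/-- Pairs `i < k`. -/
abbrev Pairs (g : ℕ) : Type := {p : Fin g × Fin g // p.1 < p.2}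

/-- The bivector field
`tr [A_i^* ∂_{A_i^*} - A_i ∂_{A_i}] ∧ tr [A_k^* ∂_{A_k^*} - A_k ∂_{A_k}]` for `i < k`. -/
def psiPair (p : Pairs g) (X : Rep g r n) : Tensor2 (Rep g r n) :=
  wedge (euler p.1.1 X) (euler p.1.2 X)

/-- The bivector field `ψ_z`. -/
def psi (z : Pairs g → ℂ) (X : Rep g r n) : Tensor2 (Rep g r n) :=
  ∑ p : Pairs g, z p • wedge (euler p.1.1 X) (euler p.1.2 X)

end CharVar

end

open scoped Matrix.Norms.Elementwise

noncomputable section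

namespace CharVar

open Matrix

variable {g r n : ℕ}

/-! Every matrix variable `C` has two half-edges, carrying the linear fields `C ξ` and `-ξ C`. Each
half-edge is a copy of an infinitesimal action of gl_n, the copies at distinct half-edges commute,
and they add up to the conjugation action (`halfField_comm_of_ne`, `sum_halfField`). For a suitable
linear order on half-edges, P_char is -1/2 times the sum of tr(E_p ∧ E_q) over p < q
(`Pchar_apply`). Inside a pair the order is: `-ξ A`, `A^* ξ`, `A ξ`, `-ξ A^*`.

Quasi-Poisson property: the bivector is quadratic in X, so its Schouten square is a cyclic sum of
commutators of linear Hamiltonian operators (`schouten_eq_commutator`). Only brackets inside a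
single half-edge survive. Euler fields are half-edge fields of the central element 1, so they
commute with everything and the coefficients z drop out (`hamOp_comm`). What remains is a triple sum
of tr(a_p [b_q, c_u]), weighted by a cyclic expression in order signs which is 1 off the diagonal p
= q = u and 0 on it (`hsign_cyclic`). The unweighted diagonal part vanishes anyway because the two
ends of a variable cancel (`sum_trLie_halfMat`). The triple sum thus factors through the sums over
all half-edges, that is, through the conjugation action, and is the Cartan trivector
(`cartanTrivector_eq`).

Moment map: moving a half-edge of a commutator `A B A⁻¹ B⁻¹` carries an insertion of ξ from one
place to the next, in the same order as above. Order-weighted sums of these derivatives therefore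
telescope; the end terms `ξ Φ` and `Φ ξ` account for 𝒟(F), and the rest is the same for the two ends
of a variable after conjugating ξ (`sum_hsign_momentDeriv_conj`). Hence it contributes nothing to
the Hamiltonian field (`hamOp_momentMap`). Euler fields preserve Φ, because commutators do not see
scalings, so ψ_z does not disturb the moment condition.

Order: at the tuple of identity matrices the Euler fields are independent, hence so are their
pairwise wedges (`linearIndependent_psiPair`). -/

/-- Covectors of a normed space. -/
abbrev Covector (V : Type*) [NormedAddCommGroup V] [NormedSpace ℂ V] : Type _ := StrongDual ℂ V

/-! ### Half-edges and the vector fields they generate -/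

/-- Half-edges: `(c, true)` carries the vector fields `X_c ξ`, and `(c, false)` carries `-ξ X_c`. -/
abbrev HalfEdge (g r : ℕ) : Type := Gen g r × Bool

/-- The linear vector field generated by `ξ` at a half-edge. -/
def halfField (p : HalfEdge g r) (ξ : Matrix (Fin n) (Fin n) ℂ) (X : Rep g r n) : Rep g r n :=
  Pi.single p.1 (if p.2 then X p.1 * ξ else -(ξ * X p.1))

theorem halfField_add_left (p : HalfEdge g r) (ξ η : Matrix (Fin n) (Fin n) ℂ) (X : Rep g r n) :
    halfField p (ξ + η) X = halfField p ξ X + halfField p η X := by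
  rw [halfField, halfField, halfField, ← Pi.single_add]
  congr 1
  split_ifs
  · rw [mul_add]
  · rw [add_mul, neg_add]

theorem halfField_smul_left (p : HalfEdge g r) (a : ℂ) (ξ : Matrix (Fin n) (Fin n) ℂ)
    (X : Rep g r n) : halfField p (a • ξ) X = a • halfField p ξ X := by
  rw [halfField, halfField, ← Pi.single_smul]
  congr 1
  split_ifs <;> simp

theorem halfField_add (p : HalfEdge g r) (ξ : Matrix (Fin n) (Fin n) ℂ) (X Y : Rep g r n) :
    halfField p ξ (X + Y) = halfField p ξ X + halfField p ξ Y := by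
  rw [halfField, halfField, halfField, ← Pi.single_add]
  congr 1
  split_ifs
  · rw [Pi.add_apply, add_mul]
  · rw [Pi.add_apply, mul_add, neg_add]

theorem halfField_smul (p : HalfEdge g r) (a : ℂ) (ξ : Matrix (Fin n) (Fin n) ℂ)
    (X : Rep g r n) : halfField p ξ (a • X) = a • halfField p ξ X := by
  rw [halfField, halfField, ← Pi.single_smul]
  congr 1
  split_ifs <;> simp

/-- `halfField` as a bilinear map. -/
def halfFieldₗ (p : HalfEdge g r) : Matrix (Fin n) (Fin n) ℂ →ₗ[ℂ] Rep g r n →ₗ[ℂ] Rep g r n :=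
  LinearMap.mk₂ ℂ (halfField p) (halfField_add_left p) (halfField_smul_left p)
    (halfField_add p) (fun a ξ X => halfField_smul p a ξ X)

@[simp] theorem halfFieldₗ_apply (p : HalfEdge g r) (ξ : Matrix (Fin n) (Fin n) ℂ)
    (X : Rep g r n) : halfFieldₗ p ξ X = halfField p ξ X := rfl

theorem sum_halfField (ξ : Matrix (Fin n) (Fin n) ℂ) (X : Rep g r n) :
    ∑ p, halfField p ξ X = infAct ξ X := by
  rw [Fintype.sum_prod_type]
  funext c
  simp only [Fintype.sum_bool, halfField, Finset.sum_apply, Pi.add_apply, infAct]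
  rw [Finset.sum_eq_single c]
  · simp [sub_eq_add_neg]
  · intro b _ hb
    simp [Pi.single_eq_of_ne hb.symm]
  · simp

/-- The factors on the right appear in reversed order because this is a commutator of linear
operators; the Lie bracket of the corresponding linear vector fields has the opposite sign. -/
theorem halfField_comm (p : HalfEdge g r) (ξ η : Matrix (Fin n) (Fin n) ℂ) (X : Rep g r n) :
    halfField p ξ (halfField p η X) - halfField p η (halfField p ξ X)
      = halfField p (η * ξ - ξ * η) X := by
  obtain ⟨c, b⟩ := p
  cases b <;> simp only [halfField, ← Pi.single_sub, Pi.single_eq_same] <;> congr 1 <;>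
    simp [mul_sub, sub_mul, mul_assoc]

/-- At one generator, left and right multiplications commute. At two different generators both
composites vanish, since each field has a single nonzero coordinate. -/
theorem halfField_comm_of_ne {p q : HalfEdge g r} (h : p ≠ q) (ξ η : Matrix (Fin n) (Fin n) ℂ)
    (X : Rep g r n) :
    halfField p ξ (halfField q η X) = halfField q η (halfField p ξ X) := by
  obtain ⟨c, b⟩ := p
  obtain ⟨d, e⟩ := q
  by_cases hcd : c = d
  · subst hcd
    cases b <;> cases e <;> simp_all [halfField, mul_assoc]
  · simp [halfField, Pi.single_eq_of_ne hcd, Pi.single_eq_of_ne (Ne.symm hcd)]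

/-! ### Components of covectors along half-edges -/

/-- The matrix `a` with `tr (a ξ) = α (halfField p ξ X)`. -/
def halfMat (α : Covector (Rep g r n)) (p : HalfEdge g r) (X : Rep g r n) :
    Matrix (Fin n) (Fin n) ℂ :=
  Matrix.of fun k l => α (halfField p (Matrix.single l k 1) X)

theorem trace_halfMat_mul (α : Covector (Rep g r n)) (p : HalfEdge g r) (X : Rep g r n)
    (ξ : Matrix (Fin n) (Fin n) ℂ) : (halfMat α p X * ξ).trace = α (halfField p ξ X) := by
  have h : α (halfField p ξ X)
      = ∑ l, ∑ k, α (halfField p (Matrix.single l k (ξ l k)) X) := by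
    conv_lhs => rw [Matrix.matrix_eq_sum_single ξ, ← halfFieldₗ_apply]
    simp only [map_sum, LinearMap.sum_apply, halfFieldₗ_apply]
  rw [h, Finset.sum_comm]
  simp only [Matrix.trace, Matrix.diag, Matrix.mul_apply, halfMat, Matrix.of_apply]
  refine Finset.sum_congr rfl fun k _ => Finset.sum_congr rfl fun l _ => ?_
  have : (Matrix.single l k (ξ l k) : Matrix (Fin n) (Fin n) ℂ)
      = ξ l k • Matrix.single l k (1 : ℂ) := by simp
  rw [this, halfField_smul_left, map_smul, smul_eq_mul, mul_comm]

theorem trace_mul_halfMat (α : Covector (Rep g r n)) (p : HalfEdge g r) (X : Rep g r n)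
    (ξ : Matrix (Fin n) (Fin n) ℂ) : (ξ * halfMat α p X).trace = α (halfField p ξ X) := by
  rw [Matrix.trace_mul_comm, trace_halfMat_mul]

theorem eq_of_trace_mul_eq {A B : Matrix (Fin n) (Fin n) ℂ}
    (h : ∀ ξ : Matrix (Fin n) (Fin n) ℂ, (A * ξ).trace = (B * ξ).trace) : A = B := by
  ext i j
  simpa [Matrix.trace_mul_single] using h (Matrix.single j i 1)

theorem halfMat_add (α : Covector (Rep g r n)) (p : HalfEdge g r) (X Y : Rep g r n) :
    halfMat α p (X + Y) = halfMat α p X + halfMat α p Y := by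
  ext; simp [halfMat, halfField_add]

theorem halfMat_smul (α : Covector (Rep g r n)) (p : HalfEdge g r) (a : ℂ) (X : Rep g r n) :
    halfMat α p (a • X) = a • halfMat α p X := by
  ext; simp [halfMat, halfField_smul]

/-- The scalar matrix obtained by pairing a covector with a matrix of tangent vectors. -/
def pairMat (α : Covector (Rep g r n)) (D : TMat g r n) : Matrix (Fin n) (Fin n) ℂ :=
  Matrix.of fun i j => α (D i j)

/-- The transposed indices in `del` make this pairing the gradient for the trace form. -/
theorem trace_pairMat_del_mul (α : Covector (Rep g r n)) (c : Gen g r)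
    (Y : Matrix (Fin n) (Fin n) ℂ) : (pairMat α (del c) * Y).trace = α (Pi.single c Y) := by
  conv_rhs => rw [Matrix.matrix_eq_sum_single Y]
  rw [← LinearMap.single_apply (R := ℂ)]
  simp only [map_sum]
  rw [Finset.sum_comm]
  simp only [Matrix.trace, Matrix.diag, Matrix.mul_apply, pairMat, del, Matrix.of_apply]
  refine Finset.sum_congr rfl fun k _ => Finset.sum_congr rfl fun l _ => ?_
  have : (Matrix.single l k (Y l k) : Matrix (Fin n) (Fin n) ℂ)
      = Y l k • Matrix.single l k (1 : ℂ) := by simp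
  rw [this, map_smul, map_smul, smul_eq_mul, mul_comm, LinearMap.single_apply]

/-- With D the trace gradient of α at c, the two half-edge components are `D X_c` and `-X_c D`. This
is the dictionary between half-edges and the matrices of vector fields in P_char. -/
theorem halfMat_true (α : Covector (Rep g r n)) (c : Gen g r) (X : Rep g r n) :
    halfMat α (c, true) X = pairMat α (del c) * X c := by
  refine eq_of_trace_mul_eq fun ξ => ?_
  rw [trace_halfMat_mul, mul_assoc, trace_pairMat_del_mul]
  simp [halfField]

theorem halfMat_false (α : Covector (Rep g r n)) (c : Gen g r) (X : Rep g r n) :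
    halfMat α (c, false) X = -(X c * pairMat α (del c)) := by
  refine eq_of_trace_mul_eq fun ξ => ?_
  rw [trace_halfMat_mul, neg_mul, mul_assoc, Matrix.trace_neg, Matrix.trace_mul_comm, mul_assoc,
    trace_pairMat_del_mul]
  simp only [halfField, Bool.false_eq_true, if_false, Pi.single_neg, map_neg]

theorem halfField_act (h : GL (Fin n) ℂ) (p : HalfEdge g r) (ξ : Matrix (Fin n) (Fin n) ℂ)
    (X : Rep g r n) :
    halfField p ξ (act h X) = act h (halfField p
      (((h⁻¹ : GL (Fin n) ℂ) : Matrix (Fin n) (Fin n) ℂ) * ξ * (h : Matrix (Fin n) (Fin n) ℂ)) X) := by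
  have h1 : (((h⁻¹ : GL (Fin n) ℂ) : Matrix (Fin n) (Fin n) ℂ) * (h : Matrix (Fin n) (Fin n) ℂ)) = 1 :=
    Units.inv_mul h
  have h2 : ((h : Matrix (Fin n) (Fin n) ℂ) * ((h⁻¹ : GL (Fin n) ℂ) : Matrix (Fin n) (Fin n) ℂ)) = 1 :=
    Units.mul_inv h
  obtain ⟨c, b⟩ := p
  funext d
  by_cases hd : d = c
  · subst hd
    have e : ∀ A B C : Matrix (Fin n) (Fin n) ℂ, A * B = 1 → A * (B * C) = C := by
      intro A B C hAB
      rw [← mul_assoc, hAB, one_mul]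
    cases b <;>
      simp only [halfField, act, Pi.single_eq_same, Bool.false_eq_true, if_false, if_true,
        mul_assoc, mul_neg, neg_mul, h2, mul_one, e _ _ _ h2]
  · simp [halfField, act, Pi.single_eq_of_ne hd]

/-! ### The order of the half-edges -/

/-- Position of a half-edge in the linear order around the vertex. -/
def height : HalfEdge g r → ℕ
  | (Sum.inl (i, b), o) => 4 * i + if b then (if o then 1 else 3) else (if o then 2 else 0)
  | (Sum.inr j, o) => 4 * g + 2 * j + if o then 1 else 0

theorem height_injective : Function.Injective (height : HalfEdge g r → ℕ) := by
  rintro ⟨⟨i, b⟩ | j, o⟩ ⟨⟨i', b'⟩ | j', o'⟩ h <;> simp only [height] at h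
  · have : i = i' ∧ b = b' ∧ o = o' := by
      rw [Fin.ext_iff]
      revert h
      cases b <;> cases b' <;> cases o <;> cases o' <;> simp <;> omega
    obtain ⟨rfl, rfl, rfl⟩ := this
    rfl
  · exfalso
    have := i.2
    split_ifs at h <;> omega
  · exfalso
    have := i'.2
    split_ifs at h <;> omega
  · have : j = j' ∧ o = o' := by
      rw [Fin.ext_iff]
      revert h
      cases o <;> cases o' <;> simp <;> omega
    obtain ⟨rfl, rfl⟩ := this
    rfl

/-- The sign of the order relation between two natural numbers. -/
def ordSign (a b : ℕ) : ℂ := if a < b then 1 else if b < a then -1 else 0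

theorem ordSign_of_lt {a b : ℕ} (h : a < b) : ordSign a b = 1 := if_pos h

theorem ordSign_of_gt {a b : ℕ} (h : b < a) : ordSign a b = -1 := by
  rw [ordSign, if_neg h.not_gt, if_pos h]

@[simp] theorem ordSign_self (a : ℕ) : ordSign a a = 0 := by simp [ordSign]

theorem ordSign_swap (a b : ℕ) : ordSign b a = -ordSign a b := by
  rcases lt_trichotomy a b with h | rfl | h
  · rw [ordSign_of_gt h, ordSign_of_lt h]
  · simp
  · rw [ordSign_of_gt h, ordSign_of_lt h, neg_neg]

/-- For distinct numbers the smallest and the largest each contribute 1 and the middle one -1. If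
exactly two coincide, only the term of the third survives and it is a square of a sign. -/
theorem ordSign_cyclic (a b c : ℕ) :
    ordSign a b * ordSign a c + ordSign b c * ordSign b a + ordSign c a * ordSign c b
      = if a = b ∧ b = c then 0 else 1 := by
  unfold ordSign
  split_ifs <;> first | omega | norm_num

/-- The sign of the order relation between two half-edges. -/
def hsign (p q : HalfEdge g r) : ℂ := ordSign (height p) (height q)

theorem hsign_swap (p q : HalfEdge g r) : hsign q p = -hsign p q := ordSign_swap _ _

theorem hsign_cyclic (p q s : HalfEdge g r) :
    hsign p q * hsign p s + hsign q s * hsign q p + hsign s p * hsign s q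
      = if p = q ∧ q = s then 0 else 1 := by
  rw [hsign, hsign, hsign, hsign, hsign, hsign, ordSign_cyclic]
  simp only [height_injective.eq_iff]

/-! ### The Euler fields -/

/-- The trace of `C ∂_C` is the field scaling C, i.e. the half-edge field of the identity matrix. -/
theorem euler_eq (i : Fin g) (X : Rep g r n) :
    euler i X = halfField (arrow i true, true) 1 X - halfField (arrow i false, true) 1 X := by
  have h : ∀ c : Gen g r, Matrix.trace (lmul (X c) (del c)) = halfField (c, true) 1 X := by
    intro c
    simp only [Matrix.trace, Matrix.diag, lmul, del, Matrix.of_apply, halfField, if_true, mul_one]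
    conv_rhs => rw [Matrix.matrix_eq_sum_single (X c), ← LinearMap.single_apply (R := ℂ)]
    simp only [map_sum]
    refine Finset.sum_congr rfl fun k _ => Finset.sum_congr rfl fun l _ => ?_
    have : (Matrix.single k l (X c k l) : Matrix (Fin n) (Fin n) ℂ)
        = X c k l • Matrix.single k l (1 : ℂ) := by simp
    rw [this, map_smul, LinearMap.single_apply]
  rw [euler, Matrix.trace_sub, h, h]

/-- The identity is central in gl_n, so commutativity persists even when both fields live at the
same half-edge. -/
theorem halfField_one_comm (p q : HalfEdge g r) (ξ : Matrix (Fin n) (Fin n) ℂ) (X : Rep g r n) :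
    halfField p 1 (halfField q ξ X) = halfField q ξ (halfField p 1 X) := by
  by_cases h : p = q
  · subst h
    rw [← sub_eq_zero, halfField_comm]
    simpa using (halfFieldₗ_apply p 0 X).symm.trans (by simp)
  · exact halfField_comm_of_ne h _ _ _

/-- `euler i` as a linear map. -/
def eulerₗ (i : Fin g) : Rep g r n →ₗ[ℂ] Rep g r n :=
  halfFieldₗ (arrow i true, true) 1 - halfFieldₗ (arrow i false, true) 1

theorem eulerₗ_apply (i : Fin g) (X : Rep g r n) : eulerₗ i X = euler i X := by
  rw [euler_eq]; rfl

theorem euler_halfField (i : Fin g) (q : HalfEdge g r) (ξ : Matrix (Fin n) (Fin n) ℂ)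
    (X : Rep g r n) : euler i (halfField q ξ X) = halfField q ξ (euler i X) := by
  rw [euler_eq, euler_eq, halfField_one_comm, halfField_one_comm]
  exact (map_sub (halfFieldₗ q ξ) _ _).symm

theorem euler_euler (i k : Fin g) (X : Rep g r n) : euler i (euler k X) = euler k (euler i X) := by
  rw [euler_eq k X, ← eulerₗ_apply i, map_sub, eulerₗ_apply, eulerₗ_apply, euler_halfField,
    euler_halfField, ← euler_eq]

/-! ### The bivector attached to the ordered half-edges and its Hamiltonian operators -/

/-- The bivector field `-1/2 ∑_{p < q} tr (E_p ∧ E_q)` over the ordered half-edges, plus the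
combination of products of Euler fields with coefficients `ζ`. -/
def orderBivector (ζ : Fin g → Fin g → ℂ) (X : Rep g r n) (α β : Covector (Rep g r n)) : ℂ :=
  -(1 / 2) * ∑ p, ∑ q, hsign p q * (halfMat α p X * halfMat β q X).trace
    + ∑ i, ∑ k, ζ i k * (α (euler i X) * β (euler k X))

/-- The `gl_n`-component at the half-edge `q` of the Hamiltonian field of `α`. -/
def hamMat (α : Covector (Rep g r n)) (X : Rep g r n) (q : HalfEdge g r) :
    Matrix (Fin n) (Fin n) ℂ :=
  -(1 / 2 : ℂ) • ∑ p, hsign p q • halfMat α p X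

/-- The linear vector field whose value at `X` is the Hamiltonian field of `α` at `X`. -/
def hamOp (ζ : Fin g → Fin g → ℂ) (α : Covector (Rep g r n)) (X : Rep g r n) :
    Rep g r n →ₗ[ℂ] Rep g r n :=
  ∑ q, halfFieldₗ q (hamMat α X q) + ∑ i, ∑ k, (ζ i k * α (euler i X)) • eulerₗ k

theorem apply_hamOp (ζ : Fin g → Fin g → ℂ) (α β : Covector (Rep g r n)) (X Y : Rep g r n) :
    β (hamOp ζ α X Y)
      = -(1 / 2) * ∑ p, ∑ q, hsign p q * (halfMat α p X * halfMat β q Y).trace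
        + ∑ i, ∑ k, ζ i k * (α (euler i X) * β (euler k Y)) := by
  simp only [hamOp, LinearMap.add_apply, LinearMap.sum_apply, map_add, map_sum, halfFieldₗ_apply,
    LinearMap.smul_apply, map_smul, eulerₗ_apply, smul_eq_mul, mul_assoc]
  congr 1
  rw [Finset.sum_comm, Finset.mul_sum]
  refine Finset.sum_congr rfl fun q _ => ?_
  rw [← trace_mul_halfMat, hamMat, Matrix.smul_mul, Finset.sum_mul, Matrix.trace_smul,
    Matrix.trace_sum, smul_eq_mul]
  simp only [Matrix.smul_mul, Matrix.trace_smul, smul_eq_mul]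

theorem orderBivector_eq (ζ : Fin g → Fin g → ℂ) (α β : Covector (Rep g r n))
    (X : Rep g r n) : orderBivector ζ X α β = β (hamOp ζ α X X) :=
  (apply_hamOp ζ α β X X).symm

/-- Antisymmetry of `hsign` and ζ turns the polar form with frozen second argument into minus a
Hamiltonian operator of the other covector. -/
theorem apply_hamOp_swap {ζ : Fin g → Fin g → ℂ} (hζ : ∀ i k, ζ k i = -ζ i k)
    (α β : Covector (Rep g r n)) (X Y : Rep g r n) :
    -(1 / 2) * ∑ p, ∑ q, hsign p q * (halfMat α p Y * halfMat β q X).trace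
        + ∑ i, ∑ k, ζ i k * (α (euler i Y) * β (euler k X)) = -α (hamOp ζ β X Y) := by
  rw [apply_hamOp, Finset.sum_comm, Finset.sum_comm (γ := Fin g), neg_add, ← mul_neg,
    ← Finset.sum_neg_distrib, ← Finset.sum_neg_distrib]
  congr 1
  · congr 1
    refine Finset.sum_congr rfl fun q _ => ?_
    rw [← Finset.sum_neg_distrib]
    refine Finset.sum_congr rfl fun p _ => ?_
    rw [hsign_swap q p, Matrix.trace_mul_comm]
    ring
  · refine Finset.sum_congr rfl fun k _ => ?_
    rw [← Finset.sum_neg_distrib]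
    refine Finset.sum_congr rfl fun i _ => ?_
    rw [hζ k i]
    ring

theorem orderBivector_swap {ζ : Fin g → Fin g → ℂ} (hζ : ∀ i k, ζ k i = -ζ i k)
    (α β : Covector (Rep g r n)) (X : Rep g r n) :
    orderBivector ζ X α β = -orderBivector ζ X β α := by
  rw [orderBivector_eq ζ β α, ← apply_hamOp_swap hζ]
  rfl

theorem orderBivector_self {ζ : Fin g → Fin g → ℂ} (hζ : ∀ i k, ζ k i = -ζ i k)
    (α : Covector (Rep g r n)) (X : Rep g r n) : orderBivector ζ X α α = 0 := by
  have h := orderBivector_swap hζ α α X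
  linear_combination (1 / 2) * h

theorem hamMat_add (α : Covector (Rep g r n)) (X Y : Rep g r n) (q : HalfEdge g r) :
    hamMat α (X + Y) q = hamMat α X q + hamMat α Y q := by
  simp only [hamMat, halfMat_add, smul_add, Finset.sum_add_distrib]

theorem hamMat_smul (α : Covector (Rep g r n)) (a : ℂ) (X : Rep g r n) (q : HalfEdge g r) :
    hamMat α (a • X) q = a • hamMat α X q := by
  simp only [hamMat, halfMat_smul, Finset.smul_sum, smul_comm a]

theorem hamOp_add (ζ : Fin g → Fin g → ℂ) (α : Covector (Rep g r n)) (X Y : Rep g r n) :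
    hamOp ζ α (X + Y) = hamOp ζ α X + hamOp ζ α Y := by
  simp only [hamOp, hamMat_add, ← eulerₗ_apply, map_add, mul_add, add_smul,
    Finset.sum_add_distrib]
  abel

theorem hamOp_smul (ζ : Fin g → Fin g → ℂ) (α : Covector (Rep g r n)) (a : ℂ) (X : Rep g r n) :
    hamOp ζ α (a • X) = a • hamOp ζ α X := by
  simp only [hamOp, hamMat_smul, ← eulerₗ_apply, map_smul, smul_add, Finset.smul_sum, smul_smul,
    smul_eq_mul, mul_left_comm]

/-- The bilinear map underlying the quadratic function `orderBivector ζ X α β` of `X`. -/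
def polarBivector (ζ : Fin g → Fin g → ℂ) (α β : Covector (Rep g r n)) :
    Rep g r n →ₗ[ℂ] Rep g r n →ₗ[ℂ] ℂ :=
  LinearMap.mk₂ ℂ (fun X Y => β (hamOp ζ α X Y))
    (fun X X' Y => by simp [hamOp_add]) (fun a X Y => by simp [hamOp_smul])
    (fun X Y Y' => by simp) (fun a X Y => by simp)

/-- Product rule for a quadratic function: varying one argument of the polar form gives the first
term, varying the other gives the second through `apply_hamOp_swap`. -/
theorem fderiv_orderBivector {ζ : Fin g → Fin g → ℂ} (hζ : ∀ i k, ζ k i = -ζ i k)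
    (α β : Covector (Rep g r n)) (X v : Rep g r n) :
    fderiv ℂ (fun Y => orderBivector ζ Y α β) X v = β (hamOp ζ α X v) - α (hamOp ζ β X v) := by
  have h := (polarBivector ζ α β).toContinuousBilinearMap.hasFDerivAt_of_bilinear
    (hasFDerivAt_id X) (hasFDerivAt_id X)
  have h' : (fun Y => orderBivector ζ Y α β) =
      fun Y => (polarBivector ζ α β).toContinuousBilinearMap (id Y) (id Y) :=
    funext fun Y => orderBivector_eq ζ α β Y
  rw [h', sub_eq_add_neg, ← apply_hamOp_swap hζ, ← apply_hamOp]
  exact DFunLike.congr_fun h.fderiv v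

/-- The Schouten square in terms of commutators of Hamiltonian operators. -/
theorem schouten_eq_commutator {P : Rep g r n → Tensor2 (Rep g r n)} {ζ : Fin g → Fin g → ℂ}
    (hζ : ∀ i k, ζ k i = -ζ i k) (hP : ∀ X α β, P X α β = orderBivector ζ X α β)
    (X : Rep g r n) (α β γ : Covector (Rep g r n)) :
    schouten P P X α β γ =
      2 * (β (hamOp ζ α X (hamOp ζ γ X X) - hamOp ζ γ X (hamOp ζ α X X))
        + γ (hamOp ζ β X (hamOp ζ α X X) - hamOp ζ α X (hamOp ζ β X X))
        + α (hamOp ζ γ X (hamOp ζ β X X) - hamOp ζ β X (hamOp ζ γ X X))) := by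
  -- Contracting P with α evaluates a covector at the Hamiltonian vector of α, so each nested
  -- bracket is a derivative of P(dβ, dγ) in that direction.
  have h : ∀ α β γ, P X α (fderiv ℂ (fun y => P y β γ) X)
      = γ (hamOp ζ β X (hamOp ζ α X X)) - β (hamOp ζ γ X (hamOp ζ α X X)) := by
    intro α β γ
    rw [hP, orderBivector_eq]
    simp only [hP]
    exact fderiv_orderBivector hζ β γ X _
  simp only [schouten, h, map_sub]
  ring

/-! ### The Schouten square -/

/-- Applied with x, y the half-edge parts of two Hamiltonian operators and z, w their Euler parts:
every cross term commutes, so only the diagonal is left. -/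
theorem lie_sum_add_sum_add {ι A : Type*} [Fintype ι] [Ring A] {x y : ι → A} {z w : A}
    (hxy : ∀ p q, p ≠ q → Commute (x p) (y q)) (hw : ∀ p, Commute (x p) w)
    (hz : ∀ p, Commute z (y p)) (hzw : Commute z w) :
    (∑ p, x p + z) * (∑ p, y p + w) - (∑ p, y p + w) * (∑ p, x p + z)
      = ∑ p, (x p * y p - y p * x p) := by
  have h1 : (∑ p, x p) * w = w * ∑ p, x p := Commute.sum_left _ _ _ fun p _ => hw p
  have h2 : z * ∑ p, y p = (∑ p, y p) * z := Commute.sum_right _ _ _ fun p _ => hz p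
  have h3 : (∑ p, x p) * (∑ p, y p) - (∑ p, y p) * ∑ p, x p = ∑ p, (x p * y p - y p * x p) := by
    rw [Finset.sum_mul_sum, Finset.sum_mul_sum, Finset.sum_comm (f := fun i j => y i * x j),
      ← Finset.sum_sub_distrib]
    refine Finset.sum_congr rfl fun p _ => ?_
    rw [← Finset.sum_sub_distrib, Finset.sum_eq_single p]
    · intro q _ hq
      rw [(hxy p q hq.symm).eq, sub_self]
    · simp
  rw [← h3, add_mul, add_mul, mul_add, mul_add, mul_add, mul_add, h1, h2, hzw.eq]
  abel

theorem hamOp_comm (ζ : Fin g → Fin g → ℂ) (α β : Covector (Rep g r n)) (X Y : Rep g r n) :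
    hamOp ζ α X (hamOp ζ β X Y) - hamOp ζ β X (hamOp ζ α X Y)
      = ∑ q, halfField q (hamMat β X q * hamMat α X q - hamMat α X q * hamMat β X q) Y := by
  have hE : ∀ (k : Fin g) (p : HalfEdge g r) (ξ : Matrix (Fin n) (Fin n) ℂ),
      Commute (halfFieldₗ p ξ : Module.End ℂ (Rep g r n)) (eulerₗ k) := by
    intro k p ξ
    refine LinearMap.ext fun Z => ?_
    rw [Module.End.mul_apply, Module.End.mul_apply, eulerₗ_apply, eulerₗ_apply, halfFieldₗ_apply,
      halfFieldₗ_apply, euler_halfField]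
  have hEE : ∀ i k : Fin g, Commute (eulerₗ i : Module.End ℂ (Rep g r n)) (eulerₗ k) := by
    intro i k
    refine LinearMap.ext fun Z => ?_
    simp only [Module.End.mul_apply, eulerₗ_apply, euler_euler i k]
  have key := lie_sum_add_sum_add (A := Module.End ℂ (Rep g r n))
    (x := fun q => halfFieldₗ q (hamMat α X q)) (y := fun q => halfFieldₗ q (hamMat β X q))
    (z := ∑ i, ∑ k, (ζ i k * α (euler i X)) • eulerₗ k)
    (w := ∑ i, ∑ k, (ζ i k * β (euler i X)) • eulerₗ k)
    (fun p q hpq => LinearMap.ext fun Z => halfField_comm_of_ne hpq _ _ _)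
    (fun p => Commute.sum_right _ _ _ fun i _ => Commute.sum_right _ _ _ fun k _ =>
      (hE k p _).smul_right _)
    (fun p => Commute.sum_left _ _ _ fun i _ => Commute.sum_left _ _ _ fun k _ =>
      (hE k p _).symm.smul_left _)
    (Commute.sum_left _ _ _ fun i _ => Commute.sum_left _ _ _ fun k _ =>
      Commute.sum_right _ _ _ fun i' _ => Commute.sum_right _ _ _ fun k' _ =>
        ((hEE k k').smul_left _).smul_right _)
  have h2 := LinearMap.congr_fun key Y
  refine h2.trans ?_
  rw [LinearMap.sum_apply]
  refine Finset.sum_congr rfl fun q _ => ?_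
  exact halfField_comm q _ _ Y

/-- The invariant trilinear form `tr (A [B, C])`. -/
def trLie (A B C : Matrix (Fin n) (Fin n) ℂ) : ℂ := (A * (B * C - C * B)).trace

theorem trLie_cycle (A B C : Matrix (Fin n) (Fin n) ℂ) : trLie A B C = trLie B C A := by
  simp only [trLie, mul_sub, Matrix.trace_sub]
  rw [← mul_assoc, Matrix.trace_mul_cycle, mul_assoc, ← mul_assoc A C B, Matrix.trace_mul_comm _ B,
    Matrix.trace_mul_comm C, mul_assoc, Matrix.trace_mul_comm A, mul_assoc]

theorem trLie_swap (A B C : Matrix (Fin n) (Fin n) ℂ) : trLie A B C = -trLie A C B := by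
  rw [trLie, trLie, ← Matrix.trace_neg, ← mul_neg, neg_sub]

theorem trLie_sum_left {ι : Type*} (s : Finset ι) (a : ι → Matrix (Fin n) (Fin n) ℂ)
    (B C : Matrix (Fin n) (Fin n) ℂ) :
    trLie (∑ p ∈ s, a p) B C = ∑ p ∈ s, trLie (a p) B C := by
  simp only [trLie, Finset.sum_mul, Matrix.trace_sum]

theorem trLie_smul_left (x : ℂ) (A B C : Matrix (Fin n) (Fin n) ℂ) :
    trLie (x • A) B C = x * trLie A B C := by
  simp only [trLie, Matrix.smul_mul, Matrix.trace_smul, smul_eq_mul]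

theorem trLie_sum_mid {ι : Type*} (s : Finset ι) (b : ι → Matrix (Fin n) (Fin n) ℂ)
    (A C : Matrix (Fin n) (Fin n) ℂ) :
    trLie A (∑ p ∈ s, b p) C = ∑ p ∈ s, trLie A (b p) C := by
  simp only [trLie_cycle A, trLie_sum_left]

theorem trLie_smul_mid (x : ℂ) (A B C : Matrix (Fin n) (Fin n) ℂ) :
    trLie A (x • B) C = x * trLie A B C := by
  simp only [trLie_cycle A, trLie_smul_left]

theorem trLie_sum_right {ι : Type*} (s : Finset ι) (c : ι → Matrix (Fin n) (Fin n) ℂ)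
    (A B : Matrix (Fin n) (Fin n) ℂ) :
    trLie A B (∑ p ∈ s, c p) = ∑ p ∈ s, trLie A B (c p) := by
  simp only [trLie_cycle A, trLie_sum_mid]

theorem trLie_smul_right (x : ℂ) (A B C : Matrix (Fin n) (Fin n) ℂ) :
    trLie A B (x • C) = x * trLie A B C := by
  simp only [trLie_cycle A, trLie_smul_mid]

theorem trLie_sum {ι : Type*} (s : Finset ι) (a b c : ι → Matrix (Fin n) (Fin n) ℂ) :
    trLie (∑ p ∈ s, a p) (∑ p ∈ s, b p) (∑ p ∈ s, c p)
      = ∑ p ∈ s, ∑ q ∈ s, ∑ u ∈ s, trLie (a p) (b q) (c u) := by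
  rw [trLie_sum_left]
  refine Finset.sum_congr rfl fun p _ => ?_
  rw [trLie_sum_mid]
  exact Finset.sum_congr rfl fun q _ => trLie_sum_right s c _ _

/-- The commutator sits at the half-edge q where β is evaluated; p and u come from the two
Hamiltonian components, each bringing a factor -1/2 and a sign relative to q. -/
theorem apply_hamOp_comm (ζ : Fin g → Fin g → ℂ) (α β γ : Covector (Rep g r n)) (X : Rep g r n) :
    β (hamOp ζ α X (hamOp ζ γ X X) - hamOp ζ γ X (hamOp ζ α X X))
      = ∑ p, ∑ q, ∑ u, (1 / 4) * (hsign q u * hsign q p) *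
          trLie (halfMat α p X) (halfMat β q X) (halfMat γ u X) := by
  rw [hamOp_comm, map_sum, Finset.sum_comm]
  refine Finset.sum_congr rfl fun q _ => ?_
  rw [← trace_halfMat_mul]
  change trLie _ _ _ = _
  rw [trLie_cycle, trLie_cycle]
  simp only [hamMat, trLie_smul_left, trLie_smul_right, trLie_sum_left, trLie_sum_right,
    Finset.mul_sum]
  refine Finset.sum_comm.trans ?_
  refine Finset.sum_congr rfl fun p _ => Finset.sum_congr rfl fun u _ => ?_
  rw [hsign_swap q p, hsign_swap q u]
  ring

/-- The contributions to the Cartan trivector of the two half-edges of a generator cancel. -/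
theorem sum_trLie_halfMat (α β γ : Covector (Rep g r n)) (X : Rep g r n) :
    ∑ p, trLie (halfMat α p X) (halfMat β p X) (halfMat γ p X) = 0 := by
  rw [Fintype.sum_prod_type]
  refine Finset.sum_eq_zero fun c _ => ?_
  simp only [Fintype.sum_bool, halfMat_true, halfMat_false]
  simp only [trLie, neg_mul, mul_neg, neg_neg, mul_sub, Matrix.trace_sub, Matrix.trace_neg,
    mul_assoc]
  rw [Matrix.trace_mul_comm (X c) (pairMat α (del c) * _),
    Matrix.trace_mul_comm (X c) (pairMat α (del c) * _)]
  simp only [mul_assoc]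
  ring

/-- After reindexing, the three commutators share one trilinear summand and carry the signs seen
from q, u and p respectively, which `hsign_cyclic` adds up. -/
theorem schouten_orderBivector {P : Rep g r n → Tensor2 (Rep g r n)} {ζ : Fin g → Fin g → ℂ}
    (hζ : ∀ i k, ζ k i = -ζ i k) (hP : ∀ X α β, P X α β = orderBivector ζ X α β)
    (X : Rep g r n) (α β γ : Covector (Rep g r n)) :
    schouten P P X α β γ = (1 / 2) *
      trLie (∑ p, halfMat α p X) (∑ p, halfMat β p X) (∑ p, halfMat γ p X) := by
  set t : HalfEdge g r → HalfEdge g r → HalfEdge g r → ℂ := fun p q u =>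
    trLie (halfMat α p X) (halfMat β q X) (halfMat γ u X) with ht
  have h1 := apply_hamOp_comm ζ α β γ X
  have h2 : γ (hamOp ζ β X (hamOp ζ α X X) - hamOp ζ α X (hamOp ζ β X X))
      = ∑ p, ∑ q, ∑ u, (1 / 4) * (hsign u p * hsign u q) * t p q u := by
    rw [apply_hamOp_comm ζ β γ α X, Finset.sum_comm_cycle]
    refine Finset.sum_congr rfl fun p _ => Finset.sum_congr rfl fun q _ =>
      Finset.sum_congr rfl fun u _ => ?_
    rw [← trLie_cycle]
  have h3 : α (hamOp ζ γ X (hamOp ζ β X X) - hamOp ζ β X (hamOp ζ γ X X))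
      = ∑ p, ∑ q, ∑ u, (1 / 4) * (hsign p q * hsign p u) * t p q u := by
    rw [apply_hamOp_comm ζ γ α β X, ← Finset.sum_comm_cycle]
    refine Finset.sum_congr rfl fun p _ => Finset.sum_congr rfl fun q _ =>
      Finset.sum_congr rfl fun u _ => ?_
    rw [trLie_cycle]
  rw [schouten_eq_commutator hζ hP, h1, h2, h3, trLie_sum]
  -- The diagonal, missing from the weighted sum, can be restored at no cost by `sum_trLie_halfMat`.
  have h4 : ∑ p, ∑ q, ∑ u, (if p = q ∧ q = u then (0 : ℂ) else 1) * t p q u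
      = ∑ p, ∑ q, ∑ u, t p q u := by
    have h5 : ∑ p, ∑ q, ∑ u, (if p = q ∧ q = u then (1 : ℂ) else 0) * t p q u = 0 := by
      refine Eq.trans ?_ (sum_trLie_halfMat α β γ X)
      refine Finset.sum_congr rfl fun p _ => ?_
      rw [Finset.sum_eq_single p, Finset.sum_eq_single p]
      · simp [ht]
      · intro u _ hu
        rw [if_neg fun h => hu h.2.symm, zero_mul]
      · simp
      · intro q _ hq
        exact Finset.sum_eq_zero fun u _ => by rw [if_neg fun h => hq h.1.symm, zero_mul]
      · simp
    refine (add_zero _).symm.trans ((congrArg _ h5.symm).trans ?_)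
    simp only [← Finset.sum_add_distrib]
    refine Finset.sum_congr rfl fun p _ => Finset.sum_congr rfl fun q _ =>
      Finset.sum_congr rfl fun u _ => ?_
    split_ifs <;> ring
  change _ = 1 / 2 * ∑ p, ∑ q, ∑ u, t p q u
  rw [← h4]
  simp only [← hsign_cyclic, ← Finset.sum_add_distrib, Finset.mul_sum]
  refine Finset.sum_congr rfl fun p _ => Finset.sum_congr rfl fun q _ =>
    Finset.sum_congr rfl fun u _ => ?_
  simp only [ht]
  ring

/-! ### The Cartan trivector in half-edge components -/

theorem sum_trLie_dualE (x y z : Fin n × Fin n → ℂ) :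
    ∑ a, ∑ b, ∑ c, trLie (dualE a) (dualE b) (dualE c) * (x a * y b * z c)
      = trLie (∑ a, x a • dualE a) (∑ a, y a • dualE a) (∑ a, z a • dualE a) := by
  rw [trLie_sum]
  simp only [trLie_smul_left, trLie_smul_mid, trLie_smul_right]
  refine Finset.sum_congr rfl fun p _ => Finset.sum_congr rfl fun q _ =>
    Finset.sum_congr rfl fun u _ => ?_
  ring

theorem sum_infAct_basisE_smul_dualE (α : Covector (Rep g r n)) (X : Rep g r n) :
    ∑ a, α (infAct (basisE a) X) • dualE a = ∑ p, halfMat α p X := by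
  ext i j
  simp only [← sum_halfField, map_sum, Matrix.sum_apply, Matrix.smul_apply, dualE,
    Matrix.single_apply, smul_eq_mul, halfMat, Matrix.of_apply]
  rw [Finset.sum_eq_single (j, i)]
  · simp [basisE]
  · rintro ⟨k, l⟩ _ h
    rw [if_neg, mul_zero]
    rintro ⟨rfl, rfl⟩
    exact h rfl
  · simp

/-- The form tr(A [B, C]) is alternating, so the six signed terms of the determinant agree, and 6/12
= 1/2. -/
theorem cartanTrivector_eq (α β γ : Covector (Rep g r n)) (X : Rep g r n) :
    cartanTrivector X α β γ = (1 / 2) *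
      trLie (∑ p, halfMat α p X) (∑ p, halfMat β p X) (∑ p, halfMat γ p X) := by
  have h : cartanTrivector X α β γ = (1 / 12) * ∑ a, ∑ b, ∑ c,
      trLie (dualE a) (dualE b) (dualE c) *
        wedge3 (infAct (basisE a) X) (infAct (basisE b) X) (infAct (basisE c) X) α β γ := rfl
  rw [h]
  have e : ∀ α β γ : Covector (Rep g r n), ∑ a, ∑ b, ∑ c,
      trLie (dualE a) (dualE b) (dualE c) * (α (infAct (basisE a) X) * β (infAct (basisE b) X) *
        γ (infAct (basisE c) X)) =
      trLie (∑ p, halfMat α p X) (∑ p, halfMat β p X) (∑ p, halfMat γ p X) := by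
    intro α β γ
    simp only [← sum_infAct_basisE_smul_dualE]
    exact sum_trLie_dualE _ _ _
  have hw : ∀ u v w : Rep g r n, wedge3 u v w α β γ = α u * β v * γ w - α u * γ v * β w
      - β u * α v * γ w + β u * γ v * α w + γ u * α v * β w - γ u * β v * α w := by
    intro u v w
    rw [wedge3, Matrix.det_fin_three]
    simp
  simp only [hw, mul_add, mul_sub, Finset.sum_add_distrib, Finset.sum_sub_distrib, e]
  set A := ∑ p, halfMat α p X
  set B := ∑ p, halfMat β p X
  set C := ∑ p, halfMat γ p X
  have h1 : trLie B C A = trLie A B C := (trLie_cycle A B C).symm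
  have h2 : trLie C A B = trLie A B C := trLie_cycle C A B
  rw [trLie_swap A C B, trLie_swap B A C, trLie_swap C B A, h1, h2]
  ring

/-! ### The explicit bivector in terms of ordered half-edges -/

theorem pairMat_lmul (α : Covector (Rep g r n)) (B : Matrix (Fin n) (Fin n) ℂ) (D : TMat g r n) :
    pairMat α (lmul B D) = B * pairMat α D := by
  ext i j
  simp [pairMat, lmul, Matrix.mul_apply]

theorem pairMat_rmul (α : Covector (Rep g r n)) (B : Matrix (Fin n) (Fin n) ℂ) (D : TMat g r n) :
    pairMat α (rmul D B) = pairMat α D * B := by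
  ext i j
  simp [pairMat, rmul, Matrix.mul_apply, mul_comm]

theorem pairMat_sub (α : Covector (Rep g r n)) (D D' : TMat g r n) :
    pairMat α (D - D') = pairMat α D - pairMat α D' := by
  ext i j
  simp [pairMat]

theorem trWedge_apply (D D' : TMat g r n) (α β : Covector (Rep g r n)) :
    trWedge D D' α β
      = (pairMat α D * pairMat β D').trace - (pairMat α D' * pairMat β D).trace := by
  simp only [trWedge, LinearMap.sum_apply, wedge_apply, Finset.sum_sub_distrib, Matrix.trace,
    Matrix.diag, Matrix.mul_apply, pairMat, Matrix.of_apply]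
  congr 1
  exact Finset.sum_comm

theorem pairMat_vArrow (α : Covector (Rep g r n)) (X : Rep g r n) (i : Fin g) (b : Bool) :
    pairMat α (vArrow X i b)
      = halfMat α (arrow i (!b), true) X + halfMat α (arrow i b, false) X := by
  rw [vArrow, pairMat_sub, pairMat_rmul, pairMat_lmul, halfMat_true, halfMat_false, sub_eq_add_neg]

theorem pairMat_vLoop (α : Covector (Rep g r n)) (X : Rep g r n) (j : Fin r) :
    pairMat α (vLoop X j) = halfMat α (loop j, true) X + halfMat α (loop j, false) X := by
  rw [vLoop, pairMat_sub, pairMat_rmul, pairMat_lmul, halfMat_true, halfMat_false, sub_eq_add_neg]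

/-- The pairing of two half-edges on two covectors. -/
def halfPair (α β : Covector (Rep g r n)) (X : Rep g r n) (p q : HalfEdge g r) : ℂ :=
  (halfMat α p X * halfMat β q X).trace

theorem sum_sum_eq_diag_add_Ioi {m : ℕ} (f : Fin m → Fin m → ℂ) :
    ∑ i, ∑ k, f i k = ∑ i, f i i + ∑ i, ∑ k ∈ Finset.Ioi i, (f i k + f k i) := by
  have h := Finset.sum_sum_Ioi_add_eq_sum_sum_off_diag f
  have h' : ∀ i, ∑ k ∈ Finset.Ioi i, (f i k + f k i) = ∑ k ∈ Finset.Ioi i, (f k i + f i k) :=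
    fun i => Finset.sum_congr rfl fun k _ => add_comm _ _
  simp only [h']
  rw [h, Finset.sum_comm, ← Finset.sum_add_distrib]
  refine Finset.sum_congr rfl fun i _ => ?_
  rw [← Finset.sum_compl_add_sum {i}, Finset.sum_singleton, add_comm]

theorem hsign_arrow_arrow {i k : Fin g} (h : i < k) (b b' o o' : Bool) :
    hsign (g := g) (r := r) (arrow i b, o) (arrow k b', o') = 1 := by
  have : (i : ℕ) < k := h
  apply ordSign_of_lt
  simp only [height]
  split_ifs <;> omega

theorem hsign_arrow_loop (i : Fin g) (j : Fin r) (b o o' : Bool) :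
    hsign (arrow i b, o) (loop j, o') = 1 := by
  have := i.2
  apply ordSign_of_lt
  simp only [height]
  split_ifs <;> omega

theorem hsign_loop_loop {i k : Fin r} (h : i < k) (o o' : Bool) :
    hsign (g := g) (r := r) (loop i, o) (loop k, o') = 1 := by
  have : (i : ℕ) < k := h
  apply ordSign_of_lt
  simp only [height]
  split_ifs <;> omega

theorem hsign_arrow_self (i : Fin g) (b b' o o' : Bool) :
    hsign (g := g) (r := r) (arrow i b, o) (arrow i b', o')
      = ordSign (if b then (if o then 1 else 3) else (if o then 2 else 0))
          (if b' then (if o' then 1 else 3) else (if o' then 2 else 0)) := by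
  simp only [hsign, height, ordSign, add_lt_add_iff_left]

theorem hsign_loop_self (j : Fin r) (o o' : Bool) :
    hsign (g := g) (r := r) (loop j, o) (loop j, o')
      = ordSign (if o then 1 else 0) (if o' then 1 else 0) := by
  simp only [hsign, height, ordSign, add_lt_add_iff_left]

/-- Cyclicity of the trace regroups the factors into `X_c ∂_c` and `∂_d X_d`, the components at (c,
false), up to sign, and (d, true). -/
theorem trWedge_lmul_del (X : Rep g r n) (c d : Gen g r) (α β : Covector (Rep g r n)) :
    trWedge (lmul (X d * X c) (del c)) (del d) α β
      = halfPair α β X (d, true) (c, false) - halfPair α β X (c, false) (d, true) := by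
  rw [trWedge_apply, halfPair, halfPair, pairMat_lmul, pairMat_lmul, halfMat_true, halfMat_true,
    halfMat_false, halfMat_false, mul_assoc (X d), mul_assoc (X d), Matrix.trace_mul_comm (X d)]
  simp only [mul_neg, neg_mul, Matrix.trace_neg, mul_assoc]
  ring

/-- `tr (E_p ∧ E_q)` evaluated on two covectors. -/
def halfWedge (α β : Covector (Rep g r n)) (X : Rep g r n) (p q : HalfEdge g r) : ℂ :=
  halfPair α β X p q - halfPair α β X q p

theorem trWedge_of_pairMat_eq (X : Rep g r n) {D D' : TMat g r n} {p p' q q' : HalfEdge g r}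
    (hD : ∀ α, pairMat α D = halfMat α p X + halfMat α p' X)
    (hD' : ∀ α, pairMat α D' = halfMat α q X + halfMat α q' X) (α β : Covector (Rep g r n)) :
    trWedge D D' α β = halfWedge α β X p q + halfWedge α β X p q' + halfWedge α β X p' q
      + halfWedge α β X p' q' := by
  rw [trWedge_apply, hD, hD, hD', hD']
  simp only [mul_add, add_mul, Matrix.trace_add, halfWedge, halfPair]
  ring

/-- The double sum is sorted by handles and loops. All half-edges of one precede all those of a
later one, so mixed terms have constant sign and assemble into the wedges of `vArrow` and `vLoop`;
the order matters in detail only inside one handle or loop. -/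
theorem Pchar_apply (X : Rep g r n) (α β : Covector (Rep g r n)) :
    Pchar X α β = -(1 / 2) * ∑ p, ∑ q, hsign p q * (halfMat α p X * halfMat β q X).trace := by
  set T := halfPair α β X with hT
  set F : Gen g r → Gen g r → ℂ := fun c d => ∑ o, ∑ o', hsign (c, o) (d, o') * T (c, o) (d, o')
    with hF
  have hsum : ∑ p, ∑ q, hsign p q * (halfMat α p X * halfMat β q X).trace
      = (∑ i : Fin g, (∑ b, ∑ b', F (arrow i b) (arrow i b'))
          + ∑ i : Fin g, ∑ k ∈ Finset.Ioi i, (∑ b, ∑ b', F (arrow i b) (arrow k b')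
            + ∑ b, ∑ b', F (arrow k b) (arrow i b')))
        + (∑ i : Fin g, ∑ b, ∑ j : Fin r, (F (arrow i b) (loop j) + F (loop j) (arrow i b)))
        + (∑ j : Fin r, F (loop j) (loop j)
          + ∑ j : Fin r, ∑ k ∈ Finset.Ioi j, (F (loop j) (loop k) + F (loop k) (loop j))) := by
    have h0 : ∑ p, ∑ q, hsign p q * (halfMat α p X * halfMat β q X).trace
        = ∑ c, ∑ d, F c d := by
      rw [Fintype.sum_prod_type]
      refine Finset.sum_congr rfl fun c _ => ?_
      simp only [hF, Fintype.sum_prod_type]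
      exact Finset.sum_comm
    rw [h0, ← sum_sum_eq_diag_add_Ioi (fun j k => F (loop j) (loop k)),
      ← sum_sum_eq_diag_add_Ioi (fun i k => ∑ b, ∑ b', F (arrow i b) (arrow k b'))]
    simp only [Fintype.sum_sum_type, Finset.sum_add_distrib]
    have h1 : ∑ i : Fin g, ∑ b, ∑ j : Fin r, F (loop j) (arrow i b)
        = ∑ j : Fin r, ∑ x : Fin g × Bool, F (loop j) (Sum.inl x) := by
      rw [Finset.sum_comm (γ := Fin r), Fintype.sum_prod_type]
    have h2 : ∑ i : Fin g, ∑ k : Fin g, ∑ b, ∑ b', F (arrow i b) (arrow k b')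
        = ∑ x : Fin g × Bool, ∑ y : Fin g × Bool, F (Sum.inl x) (Sum.inl y) := by
      simp only [Fintype.sum_prod_type]
      exact Finset.sum_congr rfl fun i _ => Finset.sum_comm
    rw [h1, h2, ← Fintype.sum_prod_type (f := fun x : Fin g × Bool => ∑ j, F (Sum.inl x) (loop j))]
    ring
  have tAA := fun (i k : Fin g) (b b' : Bool) => trWedge_of_pairMat_eq X
    (fun α => pairMat_vArrow α X i b) (fun α => pairMat_vArrow α X k b') α β
  have tAL := fun (i : Fin g) (j : Fin r) (b : Bool) => trWedge_of_pairMat_eq X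
    (fun α => pairMat_vArrow α X i b) (fun α => pairMat_vLoop α X j) α β
  have tLL := fun (j k : Fin r) => trWedge_of_pairMat_eq X
    (fun α => pairMat_vLoop α X j) (fun α => pairMat_vLoop α X k) α β
  -- `vArrow X i false` holds the half-edges at places 1, 0 and `vArrow X i true` those at 2, 3.
  -- Their wedge gives the four cross pairs; the pairs (0, 1) and (2, 3) come from the two remaining
  -- terms.
  have e1 : ∀ i : Fin g, ∑ b, ∑ b', F (arrow i b) (arrow i b')
      = trWedge (vArrow X i false) (vArrow X i true) α β
        - (trWedge (lmul (X (arrow i true) * X (arrow i false)) (del (arrow i false)))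
            (del (arrow i true)) α β
          - trWedge (lmul (X (arrow i false) * X (arrow i true)) (del (arrow i true)))
            (del (arrow i false)) α β) := by
    intro i
    rw [tAA, trWedge_lmul_del, trWedge_lmul_del]
    simp only [hF, Fintype.sum_bool, hsign_arrow_self, halfWedge, ← hT, ordSign]
    simp
    ring
  have e2 : ∀ i : Fin g, ∀ k ∈ Finset.Ioi i, ∑ b, ∑ b', F (arrow i b) (arrow k b')
      + ∑ b, ∑ b', F (arrow k b) (arrow i b')
        = ∑ b, ∑ b', trWedge (vArrow X i b) (vArrow X k b') α β := by
    intro i k hk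
    have hk' := Finset.mem_Ioi.1 hk
    simp only [tAA, hF, Fintype.sum_bool, hsign_swap (arrow i _, _) (arrow k _, _),
      hsign_arrow_arrow hk', halfWedge, ← hT, Bool.not_true, Bool.not_false]
    ring
  have e3 : ∀ (i : Fin g) (j : Fin r), ∑ b, (F (arrow i b) (loop j) + F (loop j) (arrow i b))
        = ∑ b, trWedge (vArrow X i b) (vLoop X j) α β := by
    intro i j
    simp only [tAL, hF, Fintype.sum_bool, hsign_swap (arrow i _, _) (loop j, _),
      hsign_arrow_loop, halfWedge, ← hT, Bool.not_true, Bool.not_false]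
    ring
  have e4 : ∀ j : Fin r, F (loop j) (loop j)
      = -trWedge (lmul (X (loop j) ^ 2) (del (loop j))) (del (loop j)) α β := by
    intro j
    rw [sq, trWedge_lmul_del]
    simp only [hF, Fintype.sum_bool, hsign_loop_self, ← hT, ordSign]
    simp
    ring
  have e5 : ∀ j : Fin r, ∀ k ∈ Finset.Ioi j, F (loop j) (loop k) + F (loop k) (loop j)
        = trWedge (vLoop X j) (vLoop X k) α β := by
    intro j k hk
    have hk' := Finset.mem_Ioi.1 hk
    simp only [tLL, hF, Fintype.sum_bool, hsign_swap (loop j, _) (loop k, _),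
      hsign_loop_loop hk', halfWedge, ← hT]
    ring
  have e3' : ∀ i : Fin g, ∑ b, ∑ j : Fin r, (F (arrow i b) (loop j) + F (loop j) (arrow i b))
      = ∑ b, ∑ j, trWedge (vArrow X i b) (vLoop X j) α β := by
    intro i
    rw [Finset.sum_comm, Finset.sum_congr rfl fun j _ => e3 i j, Finset.sum_comm]
  rw [hsum, Finset.sum_congr rfl fun i _ => e1 i,
    Finset.sum_congr rfl fun i _ => Finset.sum_congr rfl (e2 i),
    Finset.sum_congr rfl fun i _ => e3' i, Finset.sum_congr rfl fun j _ => e4 j,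
    Finset.sum_congr rfl fun j _ => Finset.sum_congr rfl (e5 j), Pchar]
  simp only [LinearMap.add_apply, LinearMap.sub_apply, LinearMap.smul_apply, LinearMap.sum_apply,
    smul_eq_mul, Finset.sum_sub_distrib, Finset.sum_neg_distrib]
  ring

/-! ### The members of the pencil -/

/-- The antisymmetric extension of a family of coefficients indexed by pairs `i < k`. -/
def antisymm (z : Pairs g → ℂ) (i k : Fin g) : ℂ :=
  if h : i < k then z ⟨(i, k), h⟩ else if h : k < i then -z ⟨(k, i), h⟩ else 0

theorem antisymm_swap (z : Pairs g → ℂ) (i k : Fin g) : antisymm z k i = -antisymm z i k := by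
  rcases lt_trichotomy i k with h | rfl | h
  · simp [antisymm, h, h.not_gt]
  · simp [antisymm]
  · simp [antisymm, h, h.not_gt]

theorem sum_Pairs {M : Type*} [AddCommMonoid M] (f : Fin g → Fin g → M) :
    ∑ p : Pairs g, f p.1.1 p.1.2 = ∑ i, ∑ k ∈ Finset.Ioi i, f i k := by
  rw [← Finset.sum_subtype (Finset.univ.filter fun p : Fin g × Fin g => p.1 < p.2) (by simp)
    (fun p => f p.1 p.2), Finset.sum_filter, Fintype.sum_prod_type]
  refine Finset.sum_congr rfl fun i _ => ?_
  rw [← Finset.sum_filter]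
  exact Finset.sum_congr (by ext; simp) fun _ _ => rfl

theorem member_apply (z : Pairs g → ℂ) (X : Rep g r n) (α β : Covector (Rep g r n)) :
    (Pchar + psi z : Rep g r n → Tensor2 (Rep g r n)) X α β
      = orderBivector (antisymm z) X α β := by
  change Pchar X α β + psi z X α β = _
  rw [Pchar_apply, orderBivector, sum_sum_eq_diag_add_Ioi (fun i k => antisymm z i k * _)]
  congr 1
  have h0 : ∀ i, antisymm z i i = 0 := fun i => by simp [antisymm]
  simp only [h0, zero_mul, Finset.sum_const_zero, zero_add]
  rw [← sum_Pairs, psi]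
  simp only [LinearMap.sum_apply, LinearMap.smul_apply, wedge_apply, smul_eq_mul]
  refine Finset.sum_congr rfl fun p _ => ?_
  have h : antisymm z p.1.1 p.1.2 = z p := dif_pos p.2
  rw [antisymm_swap z p.1.1 p.1.2, h]
  ring

theorem pencilMembers_eq :
    pencilMembers (Pchar (g := g) (r := r) (n := n)) psiPair
      = Set.range (fun z : Pairs g → ℂ => Pchar + psi z) := by
  have key : ∀ z : Pairs g → ℂ,
      psi (r := r) (n := n) z = ∑ p, z p • psiPair p := by
    intro z
    funext X
    simp [psi, psiPair]
  ext Q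
  constructor
  · rintro ⟨J, c, rfl⟩
    -- Coefficients are extended by zero outside the finite subset.
    refine ⟨fun p => if p ∈ J then c p else 0, ?_⟩
    simp [key, ite_smul, Finset.sum_ite_mem]
  · rintro ⟨z, rfl⟩
    exact ⟨Finset.univ, z, by simp only [key]⟩

/-- The centre is the member with z = 0, so it needs no separate verification. -/
theorem Pchar_mem_range : ∃ z : Pairs g → ℂ, Pchar (g := g) (r := r) (n := n) = Pchar + psi z := by
  refine ⟨0, ?_⟩
  funext X
  simp [psi]

/-! ### Regular functions -/

namespace IsRegular

variable {f f' : Rep g r n → ℂ}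

theorem add (hf : IsRegular f) (hf' : IsRegular f') : IsRegular fun X => f X + f' X :=
  Subalgebra.add_mem _ hf hf'

theorem mul (hf : IsRegular f) (hf' : IsRegular f') : IsRegular fun X => f X * f' X :=
  Subalgebra.mul_mem _ hf hf'

theorem const (a : ℂ) : IsRegular fun _ : Rep g r n => a :=
  Subalgebra.algebraMap_mem (regularFunctions g r n) a

theorem sum {ι : Type*} (s : Finset ι) {F : ι → Rep g r n → ℂ} (h : ∀ i ∈ s, IsRegular (F i)) :
    IsRegular fun X => ∑ i ∈ s, F i X := by
  have := Subalgebra.sum_mem (regularFunctions g r n) h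
  rw [IsRegular]
  convert this using 1
  funext X
  simp

theorem prod {ι : Type*} (s : Finset ι) {F : ι → Rep g r n → ℂ} (h : ∀ i ∈ s, IsRegular (F i)) :
    IsRegular fun X => ∏ i ∈ s, F i X := by
  have := Subalgebra.prod_mem (regularFunctions g r n) h
  rw [IsRegular]
  convert this using 1
  funext X
  simp

theorem entry (c : Gen g r) (i j : Fin n) : IsRegular fun X : Rep g r n => X c i j :=
  Algebra.subset_adjoin (Or.inl ⟨(c, i, j), rfl⟩)

theorem inv_det (c : Gen g r) : IsRegular fun X : Rep g r n => ((X c).det)⁻¹ :=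
  Algebra.subset_adjoin (Or.inr ⟨c, rfl⟩)

theorem linear (f : Rep g r n →ₗ[ℂ] ℂ) : IsRegular f := by
  have h : (f : Rep g r n → ℂ) = fun X =>
      ∑ c, ∑ i, ∑ j, X c i j * f (Pi.single c (Matrix.single i j 1)) := by
    funext X
    conv_lhs => rw [← Finset.univ_sum_single X]
    rw [map_sum]
    refine Finset.sum_congr rfl fun c _ => ?_
    conv_lhs => rw [Matrix.matrix_eq_sum_single (X c), ← LinearMap.single_apply (R := ℂ)]
    simp only [map_sum]
    refine Finset.sum_congr rfl fun i _ => Finset.sum_congr rfl fun j _ => ?_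
    have : (Matrix.single i j (X c i j) : Matrix (Fin n) (Fin n) ℂ)
        = X c i j • Matrix.single i j (1 : ℂ) := by simp
    rw [this, map_smul, map_smul, smul_eq_mul, LinearMap.single_apply]
  rw [h]
  exact sum _ fun c _ => sum _ fun i _ => sum _ fun j _ => (entry c i j).mul (const _)

end IsRegular

theorem isRegular_halfMat (α : Covector (Rep g r n)) (p : HalfEdge g r) (i j : Fin n) :
    IsRegular fun X => halfMat α p X i j :=
  IsRegular.linear (α.toLinearMap ∘ₗ halfFieldₗ p (Matrix.single j i 1))

theorem isRegular_euler (α : Covector (Rep g r n)) (i : Fin g) :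
    IsRegular fun X => α (euler i X) := by
  have h := IsRegular.linear (α.toLinearMap ∘ₗ eulerₗ i)
  convert h using 2 with X
  simp [eulerₗ_apply]

theorem isRegular_orderBivector (ζ : Fin g → Fin g → ℂ) (α β : Covector (Rep g r n)) :
    IsRegular fun X => orderBivector ζ X α β := by
  refine .add (.mul (.const _) (.sum _ fun p _ => .sum _ fun q _ => .mul (.const _) ?_))
    (.sum _ fun i _ => .sum _ fun k _ => .mul (.const _)
      (.mul (isRegular_euler α i) (isRegular_euler β k)))
  simp only [Matrix.trace, Matrix.diag, Matrix.mul_apply]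
  exact .sum _ fun i _ => .sum _ fun j _ =>
    .mul (isRegular_halfMat α p i j) (isRegular_halfMat β q j i)

/-! ### Invariance -/

/-- Continuous endomorphisms of a normed space. -/
abbrev Endo (V : Type*) [NormedAddCommGroup V] [NormedSpace ℂ V] : Type _ := V →L[ℂ] V

/-- The action as a continuous linear map. -/
def actL (h : GL (Fin n) ℂ) : Endo (Rep g r n) :=
  LinearMap.toContinuousLinearMap
    { toFun := act h
      map_add' := fun X Y => by funext c; simp [act, mul_add, add_mul]
      map_smul' := fun a X => by funext c; simp [act] }

theorem fderiv_act (h : GL (Fin n) ℂ) (X : Rep g r n) : fderiv ℂ (act h) X = actL h :=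
  (actL h).hasFDerivAt.fderiv

/-- Components are conjugated by h, so the traces of their products in `orderBivector` are
invariant. -/
theorem halfMat_act (h : GL (Fin n) ℂ) (α : Covector (Rep g r n)) (p : HalfEdge g r)
    (X : Rep g r n) :
    halfMat α p (act h X) = (h : Matrix (Fin n) (Fin n) ℂ) * halfMat (α.comp (actL h)) p X *
      ((h⁻¹ : GL (Fin n) ℂ) : Matrix (Fin n) (Fin n) ℂ) := by
  refine eq_of_trace_mul_eq fun ξ => ?_
  have e : ∀ A B C : Matrix (Fin n) (Fin n) ℂ,
      (B * A * C * ξ).trace = (A * (C * ξ * B)).trace := by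
    intro A B C
    rw [mul_assoc, mul_assoc, Matrix.trace_mul_comm, mul_assoc]
  rw [e, trace_halfMat_mul, trace_halfMat_mul, halfField_act]
  rfl

theorem euler_act (h : GL (Fin n) ℂ) (i : Fin g) (X : Rep g r n) :
    euler i (act h X) = act h (euler i X) := by
  have h1 : (((h⁻¹ : GL (Fin n) ℂ) : Matrix (Fin n) (Fin n) ℂ) * (h : Matrix (Fin n) (Fin n) ℂ)) = 1 :=
    Units.inv_mul h
  rw [euler_eq, euler_eq, halfField_act, halfField_act, mul_one, h1]
  exact (map_sub (actL h) _ _).symm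

theorem orderBivector_act (ζ : Fin g → Fin g → ℂ) (h : GL (Fin n) ℂ) (X : Rep g r n)
    (α β : Covector (Rep g r n)) :
    orderBivector ζ (act h X) α β
      = orderBivector ζ X (α.comp (actL h)) (β.comp (actL h)) := by
  have h1 : (((h⁻¹ : GL (Fin n) ℂ) : Matrix (Fin n) (Fin n) ℂ) * (h : Matrix (Fin n) (Fin n) ℂ)) = 1 :=
    Units.inv_mul h
  have key : ∀ A B : Matrix (Fin n) (Fin n) ℂ,
      ((h : Matrix (Fin n) (Fin n) ℂ) * A * ((h⁻¹ : GL (Fin n) ℂ) : Matrix (Fin n) (Fin n) ℂ) *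
        ((h : Matrix (Fin n) (Fin n) ℂ) * B *
          ((h⁻¹ : GL (Fin n) ℂ) : Matrix (Fin n) (Fin n) ℂ))).trace = (A * B).trace := by
    intro A B
    have e : ∀ C : Matrix (Fin n) (Fin n) ℂ,
        ((h⁻¹ : GL (Fin n) ℂ) : Matrix (Fin n) (Fin n) ℂ) * ((h : Matrix (Fin n) (Fin n) ℂ) * C)
          = C := fun C => by rw [← mul_assoc, h1, one_mul]
    simp only [mul_assoc, e]
    rw [Matrix.trace_mul_comm]
    simp only [mul_assoc, h1, mul_one]
  simp only [orderBivector, halfMat_act, key, euler_act]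
  rfl

theorem isQuasiPoisson_member (z : Pairs g → ℂ) :
    IsQuasiPoisson (Pchar (g := g) (r := r) (n := n) + psi z) where
  alternating X _ α := (member_apply z X α α).trans (orderBivector_self (antisymm_swap z) α X)
  regular α β := by
    have h := isRegular_orderBivector (antisymm z) α β
    simp only [← member_apply] at h
    exact h
  invariant h X _ α β := by
    refine (member_apply z _ α β).trans ((orderBivector_act _ h X α β).trans ?_)
    rw [← fderiv_act h X]
    exact (member_apply z X _ _).symm
  schouten_eq X _ α β γ :=
    (schouten_orderBivector (antisymm_swap z) (member_apply z) X α β γ).trans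
      (cartanTrivector_eq α β γ X).symm

/-! ### The order of the pencil -/

theorem card_Pairs (g : ℕ) : Fintype.card (Pairs g) = g * (g - 1) / 2 := by
  have h := sum_Pairs (g := g) fun _ _ => (1 : ℕ)
  simp only [Finset.sum_const, Finset.card_univ, smul_eq_mul, mul_one, Fin.card_Ioi] at h
  rw [h, Fin.sum_univ_eq_sum_range (fun i => g - 1 - i) g, ← Finset.sum_range_id]
  exact Finset.sum_range_reflect id g

theorem linearIndependent_psiPair (hn : 1 ≤ n) :
    LinearIndependent ℂ (fun p : Pairs g => psiPair (r := r) (n := n) p 1) := by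
  obtain ⟨m, rfl⟩ : ∃ m, n = m + 1 := ⟨n - 1, by omega⟩
  -- `δ i` reads the (0, 0) entry of `A_i^*`, which exists because n ≥ 1. At the identity tuple
  -- these covectors are dual to the Euler fields.
  let δ : Fin g → Covector (Rep g r (m + 1)) := fun i =>
    LinearMap.toContinuousLinearMap ((LinearMap.proj (R := ℂ) (0 : Fin (m + 1)) ∘ₗ
      (LinearMap.proj (R := ℂ) (0 : Fin (m + 1)) : (Matrix (Fin (m + 1)) (Fin (m + 1)) ℂ →ₗ[ℂ] _))) ∘ₗ
      LinearMap.proj (R := ℂ) (φ := fun _ : Gen g r => Matrix (Fin (m + 1)) (Fin (m + 1)) ℂ)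
        (arrow i true))
  have hδ : ∀ i k, δ i (euler k 1) = if i = k then 1 else 0 := by
    intro i k
    have : δ i (euler k 1) = euler k (1 : Rep g r (m + 1)) (arrow i true) 0 0 := rfl
    rw [this, euler_eq]
    by_cases h : i = k
    · subst h; simp [halfField]
    · simp [halfField, h]
  rw [Fintype.linearIndependent_iff]
  intro c hc p
  have h := congrArg (fun t : Tensor2 (Rep g r (m + 1)) => t (δ p.1.1) (δ p.1.2)) hc
  simp only [LinearMap.sum_apply, LinearMap.smul_apply, psiPair, wedge_apply, hδ,
    LinearMap.zero_apply, smul_eq_mul] at h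
  rw [Finset.sum_eq_single p] at h
  · have := p.2.ne'
    simpa [this] using h
  -- A wedge can be nonzero on this pair of covectors only if its two indices agree with theirs up
  -- to a swap, and the condition i < k excludes the swap.
  · rintro ⟨⟨i, k⟩, hik⟩ _ hne
    have hp := p.2
    obtain ⟨⟨i', k'⟩, hik'⟩ := p
    simp only at hik hik' hp ⊢
    by_cases h1 : i' = i <;> by_cases h2 : k' = k
    · subst h1 h2; exact absurd rfl hne
    · have h3 : i' ≠ k := by subst h1; exact hik.ne
      simp [h2, h3]
    · subst h2
      simp [h1]
      intro h4 h5
      subst h4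
      exact absurd h5 hik'.ne
    · by_cases h3 : i' = k
      · have h4 : k' ≠ i := by
          rintro rfl
          subst h3
          exact absurd hik hik'.not_gt
        simp [h1, h4]
      · simp [h1, h3]
  · simp

theorem hasOrder_psiPair (hn : 1 ≤ n) :
    HasOrder (psiPair (g := g) (r := r) (n := n)) (g * (g - 1) / 2) := by
  rw [← card_Pairs]
  constructor
  · refine ⟨(Fintype.equivFin (Pairs g)).symm, 1, fun c => isUnit_one, ?_⟩
    exact (linearIndependent_psiPair hn).comp _ (Equiv.injective _)
  · rintro k ⟨j, X, _, hli⟩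
    -- A repeated index would repeat a vector, so at most as many members as there are pairs can be
    -- independent.
    have hj : Function.Injective j := fun a b hab => hli.injective (by simp only [hab])
    simpa using Fintype.card_le_of_injective j hj

/-! ### Directional derivatives of matrix-valued functions -/

/-- `f` is differentiable at `X` with derivative `d` in the direction `v`. -/
structure HasDirDeriv (f : Rep g r n → Matrix (Fin n) (Fin n) ℂ) (X v : Rep g r n)
    (d : Matrix (Fin n) (Fin n) ℂ) : Prop where
  differentiableAt : DifferentiableAt ℂ f X
  fderiv_apply : fderiv ℂ f X v = d

namespace HasDirDeriv

variable {f f' : Rep g r n → Matrix (Fin n) (Fin n) ℂ} {X v : Rep g r n}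
  {d d' : Matrix (Fin n) (Fin n) ℂ}

theorem const (a : Matrix (Fin n) (Fin n) ℂ) : HasDirDeriv (fun _ => a) X v 0 :=
  ⟨differentiableAt_const a, by rw [fderiv_fun_const]; rfl⟩

theorem coord (c : Gen g r) : HasDirDeriv (fun Y => Y c) X v (v c) := by
  have h : HasFDerivAt (fun Y : Rep g r n => Y c)
      (ContinuousLinearMap.proj (R := ℂ) (φ := fun _ => Matrix (Fin n) (Fin n) ℂ) c) X :=
    (ContinuousLinearMap.proj (R := ℂ) (φ := fun _ => Matrix (Fin n) (Fin n) ℂ) c).hasFDerivAt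
  exact ⟨h.differentiableAt, DFunLike.congr_fun h.fderiv v⟩

theorem mul (hf : HasDirDeriv f X v d) (hf' : HasDirDeriv f' X v d') :
    HasDirDeriv (fun Y => f Y * f' Y) X v (d * f' X + f X * d') := by
  have h := (LinearMap.mul ℂ (Matrix (Fin n) (Fin n) ℂ)).toContinuousBilinearMap.hasFDerivAt_of_bilinear
    hf.differentiableAt.hasFDerivAt hf'.differentiableAt.hasFDerivAt
  refine ⟨h.differentiableAt, (DFunLike.congr_fun h.fderiv v).trans ?_⟩
  rw [← hf.fderiv_apply, ← hf'.fderiv_apply, add_comm]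
  rfl

theorem differentiable_det : Differentiable ℂ (fun A : Matrix (Fin n) (Fin n) ℂ => A.det) := by
  simp only [Matrix.det_apply]
  fun_prop

theorem differentiable_adjugate :
    Differentiable ℂ (fun A : Matrix (Fin n) (Fin n) ℂ => A.adjugate) := by
  refine differentiable_pi.2 fun i => differentiable_pi.2 fun j => ?_
  simp only [Matrix.adjugate_apply]
  refine differentiable_det.comp ?_
  refine differentiable_pi.2 fun k => differentiable_pi.2 fun l => ?_
  simp only [Matrix.updateRow_apply]
  split_ifs <;> fun_prop

theorem differentiableAt_inv {A : Matrix (Fin n) (Fin n) ℂ} (hA : IsUnit A) :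
    DifferentiableAt ℂ (fun A : Matrix (Fin n) (Fin n) ℂ => A⁻¹) A := by
  have hd : A.det ≠ 0 := ((Matrix.isUnit_iff_isUnit_det A).1 hA).ne_zero
  simp only [Matrix.inv_def, Ring.inverse_eq_inv']
  exact (differentiable_det.differentiableAt.inv hd).smul differentiable_adjugate.differentiableAt

theorem inv (hf : HasDirDeriv f X v d) (hX : IsUnit (f X)) :
    HasDirDeriv (fun Y => (f Y)⁻¹) X v (-((f X)⁻¹ * d * (f X)⁻¹)) := by
  have hd : (f X).det ≠ 0 := ((Matrix.isUnit_iff_isUnit_det _).1 hX).ne_zero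
  have h : HasDirDeriv (fun Y => (f Y)⁻¹) X v (fderiv ℂ (fun Y => (f Y)⁻¹) X v) :=
    ⟨(differentiableAt_inv hX).comp X hf.differentiableAt, rfl⟩
  have h1 := (hf.mul h).fderiv_apply
  -- The derivative of the inverse is read off from `f * f⁻¹ = 1`, an identity valid only near X:
  -- the matrix inverse is 0 at singular matrices.
  have h2 : (fun Y => f Y * (f Y)⁻¹) =ᶠ[nhds X] fun _ => 1 := by
    have hc : ContinuousAt (fun Y => (f Y).det) X :=
      (differentiable_det.differentiableAt.comp X hf.differentiableAt).continuousAt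
    filter_upwards [hc.eventually_ne hd] with Y hY
    exact Matrix.mul_nonsing_inv _ (isUnit_iff_ne_zero.2 hY)
  rw [h2.fderiv_eq, (const 1).fderiv_apply] at h1
  refine ⟨h.differentiableAt, ?_⟩
  have h3 : (f X)⁻¹ * (f X * fderiv ℂ (fun Y => (f Y)⁻¹) X v)
      = fderiv ℂ (fun Y => (f Y)⁻¹) X v := by
    rw [← mul_assoc, Matrix.nonsing_inv_mul _ (isUnit_iff_ne_zero.2 hd), one_mul]
  rw [← h3, eq_neg_of_add_eq_zero_right h1.symm, mul_neg, mul_assoc]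

theorem list_prod_zero {w : ℕ → Rep g r n → Matrix (Fin n) (Fin n) ℂ} (l : List ℕ)
    (hw : ∀ s ∈ l, HasDirDeriv (w s) X v 0) :
    HasDirDeriv (fun Y => (l.map fun s => w s Y).prod) X v 0 := by
  induction l with
  | nil => simpa using const 1
  | cons s l ih =>
    have h := (hw s (by simp)).mul (ih fun t ht => hw t (by simp [ht]))
    simpa using h

end HasDirDeriv

/-! ### The factors of the moment map -/

/-- The factors of the moment map, in order. -/
def factor (s : ℕ) (X : Rep g r n) : Matrix (Fin n) (Fin n) ℂ :=
  if h : s < g then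
    X (arrow ⟨s, h⟩ false) * X (arrow ⟨s, h⟩ true) * (X (arrow ⟨s, h⟩ false))⁻¹ *
      (X (arrow ⟨s, h⟩ true))⁻¹
  -- The value 1 past the last factor only serves to make `factor` total on natural numbers.
  else if h : s - g < r then X (loop ⟨s - g, h⟩) else 1

theorem factor_arrow (i : Fin g) (X : Rep g r n) :
    factor i X = X (arrow i false) * X (arrow i true) * (X (arrow i false))⁻¹ *
      (X (arrow i true))⁻¹ := by
  rw [factor, dif_pos i.2]

theorem factor_loop (j : Fin r) (X : Rep g r n) : factor (g + j) X = X (loop j) := by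
  have h : g + (j : ℕ) - g < r := by omega
  rw [factor, dif_neg (by omega), dif_pos h]
  congr
  omega

/-- The product of `m` successive factors from the `k`-th on. -/
def segment (k m : ℕ) (X : Rep g r n) : Matrix (Fin n) (Fin n) ℂ :=
  ((List.range' k m).map fun s => factor s X).prod

theorem segment_append (k m m' : ℕ) (X : Rep g r n) :
    segment k (m + m') X = segment k m X * segment (k + m) m' X := by
  rw [segment, ← List.range'_append_1, List.map_append, List.prod_append]
  rfl

@[simp] theorem segment_zero (k : ℕ) (X : Rep g r n) : segment k 0 X = 1 := rfl

@[simp] theorem segment_one (k : ℕ) (X : Rep g r n) : segment k 1 X = factor k X := by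
  simp [segment]

theorem momentMap_eq (X : Rep g r n) : momentMap X = segment 0 (g + r) X := by
  rw [momentMap, segment_append]
  congr 1
  · rw [segment, ← List.range_eq_range', List.ofFn_eq_map]
    rw [← List.map_coe_finRange_eq_range, List.map_map]
    congr 1
    exact List.map_congr_left fun i _ => (factor_arrow i X).symm
  · rw [segment, zero_add, List.ofFn_eq_map, List.range'_eq_map_range, List.map_map,
      ← List.map_coe_finRange_eq_range, List.map_map]
    congr 1
    exact List.map_congr_left fun i _ => (factor_loop i X).symm

theorem momentMap_split {s : ℕ} (hs : s < g + r) (X : Rep g r n) :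
    momentMap X = segment 0 s X * factor s X * segment (s + 1) (g + r - (s + 1)) X := by
  have h : g + r = s + 1 + (g + r - (s + 1)) := by omega
  conv_lhs => rw [momentMap_eq, h, segment_append, segment_append]
  simp

/-- The moment map varies through a single factor. -/
theorem hasDirDeriv_momentMap {s : ℕ} (hs : s < g + r) {X v : Rep g r n}
    {d : Matrix (Fin n) (Fin n) ℂ} (hd : HasDirDeriv (factor s) X v d)
    (h0 : ∀ t, t ≠ s → HasDirDeriv (factor t) X v 0) :
    HasDirDeriv momentMap X v (segment 0 s X * d * segment (s + 1) (g + r - (s + 1)) X) := by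
  have h1 : HasDirDeriv (segment 0 s) X v 0 :=
    HasDirDeriv.list_prod_zero _ fun t ht => h0 t (by simp [List.mem_range'_1] at ht; omega)
  have h2 : HasDirDeriv (segment (s + 1) (g + r - (s + 1))) X v 0 :=
    HasDirDeriv.list_prod_zero _ fun t ht => h0 t (by simp [List.mem_range'_1] at ht; omega)
  have h := (h1.mul hd).mul h2
  rw [show momentMap = fun Y => segment 0 s Y * factor s Y *
    segment (s + 1) (g + r - (s + 1)) Y from funext (momentMap_split hs)]
  simpa using h

/-! ### Insertions into the moment map and their telescoping -/

/-- The insertion of `ξ` before the `k`-th factor of the moment map. -/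
def insertion (X : Rep g r n) (ξ : Matrix (Fin n) (Fin n) ℂ) (k : ℕ) : Matrix (Fin n) (Fin n) ℂ :=
  segment 0 k X * ξ * segment k (g + r - k) X

theorem insertion_zero (X : Rep g r n) (ξ : Matrix (Fin n) (Fin n) ℂ) :
    insertion X ξ 0 = ξ * momentMap X := by
  simp [insertion, momentMap_eq]

theorem insertion_last (X : Rep g r n) (ξ : Matrix (Fin n) (Fin n) ℂ) :
    insertion X ξ (g + r) = momentMap X * ξ := by
  simp [insertion, momentMap_eq]

theorem insertion_eq {s : ℕ} (hs : s < g + r) (X : Rep g r n) (ξ : Matrix (Fin n) (Fin n) ℂ) :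
    insertion X ξ s = segment 0 s X * (ξ * factor s X) * segment (s + 1) (g + r - (s + 1)) X := by
  have h : g + r - s = 1 + (g + r - (s + 1)) := by omega
  rw [insertion, h, segment_append]
  simp [mul_assoc]

theorem insertion_succ {s : ℕ} (X : Rep g r n) (ξ : Matrix (Fin n) (Fin n) ℂ) :
    insertion X ξ (s + 1)
      = segment 0 s X * (factor s X * ξ) * segment (s + 1) (g + r - (s + 1)) X := by
  rw [insertion, segment_append]
  simp [mul_assoc]

/-- The signs are 1 before t, 0 at t and -1 after t, so two telescoping sums remain. For insertions,
the end values `Y 0` and `Y N` are `ξ Φ` and `Φ ξ`. -/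
theorem sum_ordSign_telescope {M : Type*} [AddCommGroup M] [Module ℂ M] (Y : ℕ → M) {N t : ℕ}
    (ht : t < N) :
    ∑ s ∈ Finset.range N, ordSign s t • (Y (s + 1) - Y s) = Y t + Y (t + 1) - Y 0 - Y N := by
  have h1 : ∀ m, m ≤ t → ∑ s ∈ Finset.range m, ordSign s t • (Y (s + 1) - Y s) = Y m - Y 0 := by
    intro m hm
    rw [← Finset.sum_range_sub]
    refine Finset.sum_congr rfl fun s hs => ?_
    rw [ordSign_of_lt (by simp at hs; omega), one_smul]
  obtain ⟨m, rfl⟩ : ∃ m, N = t + 1 + m := ⟨N - (t + 1), by omega⟩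
  rw [Finset.sum_range_add, Finset.sum_range_succ, h1 t le_rfl, ordSign_self, zero_smul, add_zero]
  have h2 : ∑ x ∈ Finset.range m, ordSign (t + 1 + x) t • (Y (t + 1 + x + 1) - Y (t + 1 + x))
      = -(Y (t + 1 + m) - Y (t + 1)) := by
    rw [← Finset.sum_range_sub (fun x => Y (t + 1 + x)), ← Finset.sum_neg_distrib]
    refine Finset.sum_congr rfl fun s _ => ?_
    rw [ordSign_of_gt (by omega), neg_smul, one_smul]
    rfl
  rw [h2]
  abel

/-! ### Derivatives of the moment map along the half-edge fields -/

theorem isUnit_coord {X : Rep g r n} (hX : X ∈ variety g r n) (c : Gen g r) :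
    IsUnit (X c).det := (Matrix.isUnit_iff_isUnit_det _).1 (hX c)

theorem hasDirDeriv_factor_arrow {X : Rep g r n} (hX : X ∈ variety g r n) (v : Rep g r n)
    (i : Fin g) :
    HasDirDeriv (factor i) X v
      (((v (arrow i false) * X (arrow i true) + X (arrow i false) * v (arrow i true)) *
          (X (arrow i false))⁻¹ + X (arrow i false) * X (arrow i true) *
            -((X (arrow i false))⁻¹ * v (arrow i false) * (X (arrow i false))⁻¹)) *
        (X (arrow i true))⁻¹ +
        X (arrow i false) * X (arrow i true) * (X (arrow i false))⁻¹ *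
          -((X (arrow i true))⁻¹ * v (arrow i true) * (X (arrow i true))⁻¹)) := by
  have hA := HasDirDeriv.coord (X := X) (v := v) (arrow i false)
  have hB := HasDirDeriv.coord (X := X) (v := v) (arrow i true)
  have h := ((hA.mul hB).mul (hA.inv (hX _))).mul (hB.inv (hX _))
  rw [show factor (i : ℕ) = _ from funext fun Y : Rep g r n => factor_arrow i Y]
  exact h

theorem hasDirDeriv_factor_loop (X v : Rep g r n) (j : Fin r) :
    HasDirDeriv (factor (g + j)) X v (v (loop j)) := by
  rw [show factor (g + (j : ℕ)) = _ from funext fun Y : Rep g r n => factor_loop j Y]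
  exact HasDirDeriv.coord _

/-- The position of the factor of the moment map in which a generator occurs. -/
def factorIndex : Gen g r → ℕ
  | Sum.inl (i, _) => i
  | Sum.inr j => g + j

@[simp] theorem factorIndex_arrow (i : Fin g) (b : Bool) :
    factorIndex (r := r) (Sum.inl (i, b)) = i := rfl

@[simp] theorem factorIndex_loop (j : Fin r) : factorIndex (g := g) (Sum.inr j) = g + j := rfl

theorem factorIndex_lt (c : Gen g r) : factorIndex c < g + r := by
  obtain ⟨i, b⟩ | j := c
  · exact lt_of_lt_of_le i.2 (Nat.le_add_right _ _)
  · exact Nat.add_lt_add_left j.2 g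

theorem hasDirDeriv_factor_of_ne {X : Rep g r n} (hX : X ∈ variety g r n) (c : Gen g r)
    (w : Matrix (Fin n) (Fin n) ℂ) {t : ℕ} (ht : t ≠ factorIndex c) :
    HasDirDeriv (factor t) X (Pi.single c w) 0 := by
  by_cases h : t < g
  · obtain ⟨i, rfl⟩ : ∃ i : Fin g, t = i := ⟨⟨t, h⟩, rfl⟩
    have hv : ∀ b, (Pi.single c w : Rep g r n) (arrow i b) = 0 := by
      intro b
      refine Pi.single_eq_of_ne ?_ _
      rintro rfl
      exact ht rfl
    have := hasDirDeriv_factor_arrow hX (Pi.single c w) i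
    simpa [hv] using this
  · by_cases h' : t - g < r
    · obtain ⟨j, rfl⟩ : ∃ j : Fin r, t = g + j :=
        ⟨⟨t - g, h'⟩, (Nat.add_sub_cancel' (not_lt.1 h)).symm⟩
      have hv : (Pi.single c w : Rep g r n) (loop j) = 0 := by
        refine Pi.single_eq_of_ne ?_ _
        rintro rfl
        exact ht rfl
      have := hasDirDeriv_factor_loop X (Pi.single c w) j
      rwa [hv] at this
    · have : factor t = fun _ : Rep g r n => (1 : Matrix (Fin n) (Fin n) ℂ) := by
        funext Y
        rw [factor, dif_neg h, dif_neg h']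
      rw [this]
      exact HasDirDeriv.const 1

/-- The insertion of `ξ` at the `k`-th of five places of the commutator `A B A⁻¹ B⁻¹`; the places
are ordered like the half-edges of `A` and `B`. -/
def commInsert (A B ξ : Matrix (Fin n) (Fin n) ℂ) : ℕ → Matrix (Fin n) (Fin n) ℂ
  | 0 => ξ * (A * B * A⁻¹ * B⁻¹)
  | 1 => A * B * A⁻¹ * ξ * B⁻¹
  | 2 => A * B * ξ * A⁻¹ * B⁻¹
  | 3 => A * ξ * B * A⁻¹ * B⁻¹
  | _ => A * B * A⁻¹ * B⁻¹ * ξ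

/-- The place of a half-edge of an arrow in the commutator. -/
def arrowPlace (b o : Bool) : ℕ := if b then (if o then 1 else 3) else (if o then 2 else 0)

/-- The derivative along a half-edge of the factor of the moment map containing it. -/
def factorDeriv (X : Rep g r n) (ξ : Matrix (Fin n) (Fin n) ℂ) :
    HalfEdge g r → Matrix (Fin n) (Fin n) ℂ
  | (Sum.inl (i, b), o) =>
      commInsert (X (arrow i false)) (X (arrow i true)) ξ (arrowPlace b o + 1)
        - commInsert (X (arrow i false)) (X (arrow i true)) ξ (arrowPlace b o)
  | (Sum.inr j, o) => if o then X (loop j) * ξ else -(ξ * X (loop j))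

/-- A and B each occur in the commutator together with their inverse. Moving one half-edge therefore
produces two insertions of opposite sign, at consecutive places of `commInsert`. -/
theorem hasDirDeriv_factor {X : Rep g r n} (hX : X ∈ variety g r n) (p : HalfEdge g r)
    (ξ : Matrix (Fin n) (Fin n) ℂ) :
    HasDirDeriv (factor (factorIndex p.1)) X (halfField p ξ X) (factorDeriv X ξ p) := by
  obtain ⟨⟨i, b⟩ | j, o⟩ := p
  · have h := hasDirDeriv_factor_arrow hX (halfField (arrow i b, o) ξ X) i
    refine ⟨h.differentiableAt, h.fderiv_apply.trans ?_⟩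
    have hA := isUnit_coord hX (arrow i false)
    have hB := isUnit_coord hX (arrow i true)
    have hf : (arrow i false : Gen g r) ≠ arrow i true := by simp
    generalize hA' : X (arrow i false) = A at hA ⊢
    generalize hB' : X (arrow i true) = B at hB ⊢
    cases b <;> cases o <;>
      simp only [halfField, factorDeriv, arrowPlace, commInsert, Pi.single_eq_same,
        Pi.single_eq_of_ne hf, Pi.single_eq_of_ne hf.symm, hA', hB', if_true, if_false, zero_mul,
        mul_zero, zero_add, add_zero, neg_zero, Bool.false_eq_true, mul_neg, neg_mul,
        mul_assoc, neg_neg, add_mul,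
        Matrix.nonsing_inv_mul_cancel_left _ _ hA, Matrix.nonsing_inv_mul_cancel_left _ _ hB,
        Matrix.mul_nonsing_inv _ hA, Matrix.mul_nonsing_inv _ hB, mul_one] <;>
      abel
  · have h := hasDirDeriv_factor_loop X (halfField (loop j, o) ξ X) j
    refine ⟨h.differentiableAt, h.fderiv_apply.trans ?_⟩
    simp [halfField, factorDeriv]

/-- The derivative of the moment map along a half-edge field. -/
def momentDeriv (X : Rep g r n) (ξ : Matrix (Fin n) (Fin n) ℂ) (p : HalfEdge g r) :
    Matrix (Fin n) (Fin n) ℂ :=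
  segment 0 (factorIndex p.1) X * factorDeriv X ξ p *
    segment (factorIndex p.1 + 1) (g + r - (factorIndex p.1 + 1)) X

theorem hasDirDeriv_momentMap_halfField {X : Rep g r n} (hX : X ∈ variety g r n)
    (p : HalfEdge g r) (ξ : Matrix (Fin n) (Fin n) ℂ) :
    HasDirDeriv momentMap X (halfField p ξ X) (momentDeriv X ξ p) :=
  hasDirDeriv_momentMap (factorIndex_lt p.1) (hasDirDeriv_factor hX p ξ)
    fun _ ht => hasDirDeriv_factor_of_ne hX p.1 _ ht

theorem sum_factorDeriv_arrow (X : Rep g r n) (ξ : Matrix (Fin n) (Fin n) ℂ) (i : Fin g) :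
    ∑ b, ∑ o, factorDeriv X ξ (arrow i b, o) = factor i X * ξ - ξ * factor i X := by
  simp [factorDeriv, arrowPlace, commInsert, factor_arrow]
  abel

theorem sum_factorDeriv_loop (X : Rep g r n) (ξ : Matrix (Fin n) (Fin n) ℂ) (j : Fin r) :
    ∑ o, factorDeriv X ξ (loop j, o) = factor (g + j) X * ξ - ξ * factor (g + j) X := by
  simp [factorDeriv, factor_loop, sub_eq_add_neg]

/-- The weight is constant on each factor, and the half-edges of one factor together generate its
conjugation, whose derivative is a difference of neighbouring insertions. -/
theorem sum_momentDeriv_factorIndex (X : Rep g r n) (ξ : Matrix (Fin n) (Fin n) ℂ) (f : ℕ → ℂ) :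
    ∑ p, f (factorIndex p.1) • momentDeriv X ξ p
      = ∑ s ∈ Finset.range (g + r), f s • (insertion X ξ (s + 1) - insertion X ξ s) := by
  have hins : ∀ s, s < g + r → insertion X ξ (s + 1) - insertion X ξ s =
      segment 0 s X * (factor s X * ξ - ξ * factor s X) *
        segment (s + 1) (g + r - (s + 1)) X := by
    intro s hs
    rw [insertion_succ, insertion_eq hs, mul_sub, sub_mul]
  rw [Fintype.sum_prod_type, Fintype.sum_sum_type, Finset.sum_range_add,
    ← Fin.sum_univ_eq_sum_range (fun s => f s • (insertion X ξ (s + 1) - insertion X ξ s)),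
    ← Fin.sum_univ_eq_sum_range
      (fun s => f (g + s) • (insertion X ξ (g + s + 1) - insertion X ξ (g + s))),
    Fintype.sum_prod_type]
  congr 1
  · refine Finset.sum_congr rfl fun i _ => ?_
    rw [hins i (by omega), ← sum_factorDeriv_arrow]
    simp only [momentDeriv, factorIndex, ← Finset.smul_sum, ← Finset.sum_mul, ← Finset.mul_sum]
  · refine Finset.sum_congr rfl fun j _ => ?_
    rw [hins _ (by omega), ← sum_factorDeriv_loop]
    simp only [momentDeriv, factorIndex, ← Finset.smul_sum, ← Finset.sum_mul, ← Finset.mul_sum]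

theorem hsign_of_factorIndex_ne {p q : HalfEdge g r} (h : factorIndex p.1 ≠ factorIndex q.1) :
    hsign p q = ordSign (factorIndex p.1) (factorIndex q.1) := by
  obtain ⟨⟨i, b⟩ | j, o⟩ := p <;> obtain ⟨⟨k, b'⟩ | l, o'⟩ := q <;>
    simp only [factorIndex] at h ⊢
  · rcases lt_or_gt_of_ne h with h | h
    · rw [hsign_arrow_arrow h, ordSign_of_lt h]
    · rw [hsign_swap, hsign_arrow_arrow h, ordSign_of_gt h]
  · rw [hsign_arrow_loop, ordSign_of_lt (by omega)]
  · rw [hsign_swap, hsign_arrow_loop, ordSign_of_gt (by omega)]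
  · rcases lt_or_gt_of_ne h with h | h
    · rw [hsign_loop_loop (by simpa using h), ordSign_of_lt h]
    · rw [hsign_swap, hsign_loop_loop (by simpa using h), ordSign_of_gt h]

/-- Outside the factor of q the sign depends only on the factors, so those terms telescope. The end
terms cancel against `Φ ξ + ξ Φ`, leaving an expression local to the factor of q. -/
theorem sum_hsign_momentDeriv (X : Rep g r n) (ξ : Matrix (Fin n) (Fin n) ℂ) (q : HalfEdge g r) :
    ∑ p, hsign p q • momentDeriv X ξ p + (momentMap X * ξ + ξ * momentMap X)
      = segment 0 (factorIndex q.1) X *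
        (ξ * factor (factorIndex q.1) X + factor (factorIndex q.1) X * ξ
          + ∑ p, if factorIndex p.1 = factorIndex q.1 then hsign p q • factorDeriv X ξ p else 0) *
        segment (factorIndex q.1 + 1) (g + r - (factorIndex q.1 + 1)) X := by
  set t := factorIndex q.1
  have h1 : ∑ p, hsign p q • momentDeriv X ξ p
      = ∑ p, ordSign (factorIndex p.1) t • momentDeriv X ξ p
        + ∑ p, if factorIndex p.1 = t then hsign p q • momentDeriv X ξ p else 0 := by
    rw [← Finset.sum_add_distrib]
    refine Finset.sum_congr rfl fun p _ => ?_
    split_ifs with h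
    · rw [h, ordSign_self, zero_smul, zero_add]
    · rw [hsign_of_factorIndex_ne h, add_zero]
  have h2 : ∑ p, (if factorIndex p.1 = t then hsign p q • momentDeriv X ξ p else 0)
      = segment 0 t X *
        (∑ p, if factorIndex p.1 = t then hsign p q • factorDeriv X ξ p else 0) *
          segment (t + 1) (g + r - (t + 1)) X := by
    rw [Finset.mul_sum, Finset.sum_mul]
    refine Finset.sum_congr rfl fun p _ => ?_
    split_ifs with h
    · rw [momentDeriv, h]
      simp
    · simp
  rw [h1, h2, sum_momentDeriv_factorIndex X ξ fun s => ordSign s t,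
    sum_ordSign_telescope (insertion X ξ) (factorIndex_lt q.1), insertion_zero, insertion_last,
    insertion_eq (factorIndex_lt q.1), insertion_succ]
  simp only [mul_add, add_mul]
  abel

theorem sum_factorIndex_arrow (i : Fin g) (f : HalfEdge g r → Matrix (Fin n) (Fin n) ℂ) :
    ∑ p : HalfEdge g r, (if factorIndex p.1 = i then f p else 0) = ∑ b, ∑ o, f (arrow i b, o) := by
  rw [Fintype.sum_prod_type, Fintype.sum_sum_type, Fintype.sum_prod_type,
    Finset.sum_eq_single i]
  · have h : ∑ j : Fin r, ∑ o, (if factorIndex (g := g) (Sum.inr j) = i then f (Sum.inr j, o) else 0)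
        = 0 := by
      refine Finset.sum_eq_zero fun j _ => Finset.sum_eq_zero fun o _ => if_neg ?_
      rw [factorIndex_loop]
      omega
    rw [h, add_zero]
    simp
  · intro k _ hk
    simp [Fin.val_inj, hk]
  · simp

theorem sum_factorIndex_loop (j : Fin r) (f : HalfEdge g r → Matrix (Fin n) (Fin n) ℂ) :
    ∑ p : HalfEdge g r, (if factorIndex p.1 = g + j then f p else 0) = ∑ o, f (loop j, o) := by
  rw [Fintype.sum_prod_type, Fintype.sum_sum_type, Finset.sum_eq_single j]
  · have h : ∑ x : Fin g × Bool, ∑ o, (if factorIndex (r := r) (Sum.inl x) = g + j then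
        f (Sum.inl x, o) else 0) = 0 := by
      refine Finset.sum_eq_zero fun x _ => Finset.sum_eq_zero fun o _ => if_neg ?_
      rw [factorIndex_arrow]
      omega
    rw [h, zero_add]
    simp
  · intro k _ hk
    simp [Fin.val_inj, hk]
  · simp

/-- The two half-edges of a generator see the same variation of the moment map. -/
theorem sum_hsign_momentDeriv_conj {X : Rep g r n} (hX : X ∈ variety g r n) (c : Gen g r)
    (ξ : Matrix (Fin n) (Fin n) ℂ) :
    ∑ p, hsign p (c, true) • momentDeriv X ξ p + (momentMap X * ξ + ξ * momentMap X)
      = ∑ p, hsign p (c, false) • momentDeriv X (X c * ξ * (X c)⁻¹) p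
        + (momentMap X * (X c * ξ * (X c)⁻¹) + (X c * ξ * (X c)⁻¹) * momentMap X) := by
  rw [sum_hsign_momentDeriv, sum_hsign_momentDeriv]
  refine congrArg (fun M => _ * M * _) ?_
  -- For an arrow the local expression is the sum of the insertions just before and just after the
  -- half-edge. For instance, inserting ξ at places 2 and 3 for (A, true) gives the same two words
  -- as inserting `A ξ A⁻¹` at places 1 and 0 for (A, false). For a loop both sides reduce to `Z ξ`.
  obtain ⟨i, b⟩ | j := c
  · rw [show X (Sum.inl (i, b)) = X (arrow i b) from rfl, factorIndex_arrow, sum_factorIndex_arrow i, sum_factorIndex_arrow i]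
    simp only [Fintype.sum_bool, hsign_arrow_self, factor_arrow]
    have hA := isUnit_coord hX (arrow i false)
    have hB := isUnit_coord hX (arrow i true)
    cases b <;>
      simp [ordSign, factorDeriv, arrowPlace, commInsert, mul_assoc,
        Matrix.nonsing_inv_mul_cancel_left _ _ hA, Matrix.nonsing_inv_mul_cancel_left _ _ hB] <;>
      abel
  · rw [show X (Sum.inr j) = X (loop j) from rfl, factorIndex_loop, sum_factorIndex_loop j, sum_factorIndex_loop j]
    simp only [Fintype.sum_bool, hsign_loop_self, factor_loop]
    have hZ := isUnit_coord hX (loop j)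
    simp [ordSign, factorDeriv, mul_assoc, Matrix.nonsing_inv_mul _ hZ]

/-- Inserting the identity gives the same matrix at every place, so both sides vanish: rescaling `A`
or `A^*` does not change the commutator. -/
theorem momentDeriv_one (X : Rep g r n) (i : Fin g) :
    momentDeriv X 1 (arrow i true, true) = momentDeriv X 1 (arrow i false, true) := by
  simp [momentDeriv, factorDeriv, arrowPlace, commInsert]

/-! ### The moment map condition -/

/-- 𝒟(F) is the trace gradient of the averaged left and right derivatives of F; this form allows
comparison with `hamMat` under the trace. -/
theorem trace_operD_mul (F : Matrix (Fin n) (Fin n) ℂ → ℂ) (p ξ : Matrix (Fin n) (Fin n) ℂ) :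
    (operD F p * ξ).trace = (1 / 2) * fderiv ℂ F p (p * ξ + ξ * p) := by
  have hξ : ξ = ∑ a : Fin n × Fin n, ξ a.1 a.2 • basisE a := by
    conv_lhs => rw [Matrix.matrix_eq_sum_single ξ]
    rw [Fintype.sum_prod_type]
    simp [basisE]
  have h1 : fderiv ℂ F p (p * ξ + ξ * p)
      = ∑ a : Fin n × Fin n, ξ a.1 a.2 *
          (fderiv ℂ F p (p * basisE a) + fderiv ℂ F p (basisE a * p)) := by
    conv_lhs => rw [hξ]
    rw [Finset.mul_sum, Finset.sum_mul, ← Finset.sum_add_distrib, map_sum]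
    refine Finset.sum_congr rfl fun a _ => ?_
    rw [Matrix.mul_smul, Matrix.smul_mul, ← smul_add, map_smul, map_add, smul_eq_mul]
  rw [h1, operD, Matrix.smul_mul, Matrix.trace_smul, smul_eq_mul, Finset.sum_mul,
    Matrix.trace_sum]
  congr 1
  refine Finset.sum_congr rfl fun a _ => ?_
  rw [Matrix.smul_mul, Matrix.trace_smul, smul_eq_mul, mul_comm, dualE,
    Matrix.trace_single_mul, one_smul]

/-- The components `hamMat` need not equal 𝒟(F) half-edge by half-edge. Their differences only have
to cancel between the two ends of each generator, since the field there is `X_c K_true - K_false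
X_c`. -/
theorem hamOp_momentMap (ζ : Fin g → Fin g → ℂ) {X : Rep g r n} (hX : X ∈ variety g r n)
    {F : Matrix (Fin n) (Fin n) ℂ → ℂ} (hF : DifferentiableAt ℂ F (momentMap X))
    {α : Covector (Rep g r n)} (hα : α = fderiv ℂ (fun Y => F (momentMap Y)) X) :
    hamOp ζ α X X = infAct (operD F (momentMap X)) X := by
  have hα' : ∀ p ξ, α (halfField p ξ X) = fderiv ℂ F (momentMap X) (momentDeriv X ξ p) := by
    intro p ξ
    have h := hasDirDeriv_momentMap_halfField hX p ξ
    have h2 := (hF.hasFDerivAt.comp X h.differentiableAt.hasFDerivAt).fderiv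
    rw [← h.fderiv_apply, hα]
    exact DFunLike.congr_fun h2 _
  have hE : ∀ i, α (euler i X) = 0 := by
    intro i
    rw [euler_eq, map_sub, hα', hα', momentDeriv_one, sub_self]
  have hmat : ∀ q ξ, ((hamMat α X q - operD F (momentMap X)) * ξ).trace
      = -(1 / 2) * fderiv ℂ F (momentMap X)
        (∑ p, hsign p q • momentDeriv X ξ p + (momentMap X * ξ + ξ * momentMap X)) := by
    intro q ξ
    rw [sub_mul, Matrix.trace_sub, trace_operD_mul, hamMat, Matrix.smul_mul, Finset.sum_mul,
      Matrix.trace_smul, Matrix.trace_sum, map_add _ (∑ p, hsign p q • momentDeriv X ξ p), map_sum,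
      smul_eq_mul]
    simp only [Matrix.smul_mul, Matrix.trace_smul, trace_halfMat_mul, hα', map_smul]
    ring
  -- By nondegeneracy of the trace form, this is `sum_hsign_momentDeriv_conj` composed with dF.
  have hconj : ∀ c, X c * (hamMat α X (c, true) - operD F (momentMap X))
      = (hamMat α X (c, false) - operD F (momentMap X)) * X c := by
    intro c
    have hc := isUnit_coord hX c
    have h : hamMat α X (c, true) - operD F (momentMap X)
        = (X c)⁻¹ * ((hamMat α X (c, false) - operD F (momentMap X)) * X c) := by
      refine eq_of_trace_mul_eq fun ξ => ?_
      rw [mul_assoc, mul_assoc, Matrix.trace_mul_comm (X c)⁻¹, mul_assoc, hmat, hmat,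
        sum_hsign_momentDeriv_conj hX]
    rw [h, Matrix.mul_nonsing_inv_cancel_left _ _ hc]
  rw [hamOp]
  simp only [hE, mul_zero, zero_smul, Finset.sum_const_zero, add_zero]
  rw [LinearMap.sum_apply, Fintype.sum_prod_type]
  funext c
  simp only [Fintype.sum_bool, halfFieldₗ_apply, halfField, Finset.sum_apply, Pi.add_apply, infAct]
  rw [Finset.sum_eq_single c]
  · have h := hconj c
    rw [mul_sub, sub_mul] at h
    simp only [Pi.single_eq_same, if_true, Bool.false_eq_true, if_false, ← sub_eq_add_neg]
    rw [sub_eq_sub_iff_add_eq_add, add_comm] at h ⊢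
    rw [h, add_comm]
  · intro b _ hb
    simp [Pi.single_eq_of_ne hb.symm]
  · simp

/-! ### Invertibility and equivariance of the moment map -/

theorem isUnit_factor {X : Rep g r n} (hX : X ∈ variety g r n) (s : ℕ) : IsUnit (factor s X) := by
  have hinv : ∀ c, IsUnit (X c)⁻¹ := fun c => (Matrix.isUnit_nonsing_inv_iff).2 (hX c)
  rw [factor]
  split_ifs
  · exact (((hX _).mul (hX _)).mul (hinv _)).mul (hinv _)
  · exact hX _
  · exact isUnit_one

theorem isUnit_momentMap {X : Rep g r n} (hX : X ∈ variety g r n) : IsUnit (momentMap X) := by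
  rw [momentMap_eq, segment]
  refine List.prod_isUnit fun A hA => ?_
  obtain ⟨s, -, rfl⟩ := List.mem_map.1 hA
  exact isUnit_factor hX s

theorem factor_act (h : GL (Fin n) ℂ) (s : ℕ) (X : Rep g r n) :
    factor s (act h X) = (h : Matrix (Fin n) (Fin n) ℂ) * factor s X *
      ((h⁻¹ : GL (Fin n) ℂ) : Matrix (Fin n) (Fin n) ℂ) := by
  have h1 : (((h⁻¹ : GL (Fin n) ℂ) : Matrix (Fin n) (Fin n) ℂ) * (h : Matrix (Fin n) (Fin n) ℂ)) = 1 :=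
    Units.inv_mul h
  have h2 : ((h : Matrix (Fin n) (Fin n) ℂ) * ((h⁻¹ : GL (Fin n) ℂ) : Matrix (Fin n) (Fin n) ℂ)) = 1 :=
    Units.mul_inv h
  have h3 : ((h⁻¹ : GL (Fin n) ℂ) : Matrix (Fin n) (Fin n) ℂ)⁻¹ = (h : Matrix (Fin n) (Fin n) ℂ) :=
    Matrix.inv_eq_right_inv h1
  have h4 : (h : Matrix (Fin n) (Fin n) ℂ)⁻¹ = ((h⁻¹ : GL (Fin n) ℂ) : Matrix (Fin n) (Fin n) ℂ) :=
    Matrix.inv_eq_right_inv h2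
  have e : ∀ C : Matrix (Fin n) (Fin n) ℂ,
      ((h⁻¹ : GL (Fin n) ℂ) : Matrix (Fin n) (Fin n) ℂ) * ((h : Matrix (Fin n) (Fin n) ℂ) * C)
        = C := fun C => by rw [← mul_assoc, h1, one_mul]
  simp only [factor]
  split_ifs
  · simp only [act, Matrix.mul_inv_rev, h3, h4, mul_assoc, e]
  · rfl
  · rw [mul_one, h2]

theorem momentMap_act (h : GL (Fin n) ℂ) (X : Rep g r n) :
    momentMap (act h X) = (h : Matrix (Fin n) (Fin n) ℂ) * momentMap X *
      ((h⁻¹ : GL (Fin n) ℂ) : Matrix (Fin n) (Fin n) ℂ) := by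
  have h1 : (((h⁻¹ : GL (Fin n) ℂ) : Matrix (Fin n) (Fin n) ℂ) * (h : Matrix (Fin n) (Fin n) ℂ)) = 1 :=
    Units.inv_mul h
  have h2 : ((h : Matrix (Fin n) (Fin n) ℂ) * ((h⁻¹ : GL (Fin n) ℂ) : Matrix (Fin n) (Fin n) ℂ)) = 1 :=
    Units.mul_inv h
  rw [momentMap_eq, momentMap_eq, segment, segment]
  generalize List.range' 0 (g + r) = l
  induction l with
  | nil => simp only [List.map_nil, List.prod_nil, mul_one, h2]
  | cons s l ih =>
    rw [List.map_cons, List.prod_cons, ih, factor_act, List.map_cons, List.prod_cons]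
    simp only [mul_assoc]
    rw [← mul_assoc _ (h : Matrix (Fin n) (Fin n) ℂ), h1, one_mul]

/-! ### Regularity of the moment map -/

/-- All entries are regular functions. -/
def IsRegularMat (f : Rep g r n → Matrix (Fin n) (Fin n) ℂ) : Prop :=
  ∀ i j, IsRegular fun X => f X i j

namespace IsRegularMat

variable {f f' : Rep g r n → Matrix (Fin n) (Fin n) ℂ}

theorem const (A : Matrix (Fin n) (Fin n) ℂ) : IsRegularMat fun _ : Rep g r n => A :=
  fun _ _ => .const _

theorem coord (c : Gen g r) : IsRegularMat fun X : Rep g r n => X c := fun _ _ => .entry c _ _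

theorem mul (hf : IsRegularMat f) (hf' : IsRegularMat f') : IsRegularMat fun X => f X * f' X := by
  intro i j
  simp only [Matrix.mul_apply]
  exact .sum _ fun k _ => (hf i k).mul (hf' k j)

theorem det (hf : IsRegularMat f) : IsRegular fun X => (f X).det := by
  simp only [Matrix.det_apply']
  exact .sum _ fun σ _ => .mul (.const _) (.prod _ fun i _ => hf _ _)

theorem inv_coord (c : Gen g r) : IsRegularMat fun X : Rep g r n => (X c)⁻¹ := by
  intro i j
  simp only [Matrix.inv_def, Ring.inverse_eq_inv', Matrix.smul_apply, smul_eq_mul,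
    Matrix.adjugate_apply]
  refine .mul (.inv_det c) (det fun k l => ?_)
  simp only [Matrix.updateRow_apply]
  split_ifs
  · exact .const _
  · exact .entry c k l

theorem list_prod {w : ℕ → Rep g r n → Matrix (Fin n) (Fin n) ℂ} (hw : ∀ s, IsRegularMat (w s))
    (l : List ℕ) : IsRegularMat fun X => (l.map fun s => w s X).prod := by
  induction l with
  | nil => simpa using const 1
  | cons s l ih => simpa using (hw s).mul ih

end IsRegularMat

theorem isRegularMat_factor (s : ℕ) : IsRegularMat (factor (g := g) (r := r) (n := n) s) := by
  unfold factor
  split_ifs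
  · exact (((IsRegularMat.coord _).mul (.coord _)).mul (.inv_coord _)).mul (.inv_coord _)
  · exact .coord _
  · exact .const 1

theorem isRegular_inv_det_factor (s : ℕ) :
    IsRegular fun X : Rep g r n => ((factor s X).det)⁻¹ := by
  unfold factor
  split_ifs
  · simp only [Matrix.det_mul, Matrix.det_nonsing_inv, Ring.inverse_eq_inv', mul_inv, inv_inv]
    exact (((IsRegular.inv_det _).mul (.inv_det _)).mul (IsRegularMat.coord _).det).mul
      (IsRegularMat.coord _).det
  · exact .inv_det _
  · simpa using IsRegular.const 1

theorem isRegular_inv_det_momentMap :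
    IsRegular fun X : Rep g r n => ((momentMap X).det)⁻¹ := by
  simp only [momentMap_eq, segment]
  generalize List.range' 0 (g + r) = l
  induction l with
  | nil => simpa using IsRegular.const 1
  | cons s l ih =>
    simp only [List.map_cons, List.prod_cons, Matrix.det_mul, mul_inv]
    exact (isRegular_inv_det_factor s).mul ih

theorem isMomentMap_member (z : Pairs g → ℂ) :
    IsMomentMap (Pchar (g := g) (r := r) (n := n) + psi z) momentMap where
  isUnit _ hX := isUnit_momentMap hX
  regular := by
    simp only [momentMap_eq]
    exact IsRegularMat.list_prod isRegularMat_factor _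
  regular_inv_det := isRegular_inv_det_momentMap
  equivariant h X _ := momentMap_act h X
  moment X hX F hF β := by
    refine (member_apply z X _ β).trans ((orderBivector_eq _ _ β X).trans ?_)
    exact congrArg β (hamOp_momentMap _ hX hF rfl)

end CharVar

end

/-! ### The Hamiltonian quasi-Poisson pencil -/

theorem theorem3p12 (g r n : ℕ) (hgr : 0 < r + g) (hn : 1 ≤ n) :
    CharVar.IsHamiltonianPencil (CharVar.Pchar (g := g) (r := r) (n := n))
        CharVar.psiPair CharVar.momentMap ∧
      CharVar.HasOrder (CharVar.psiPair (g := g) (r := r) (n := n)) (g * (g - 1) / 2) ∧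
      CharVar.pencilMembers (CharVar.Pchar (g := g) (r := r) (n := n)) CharVar.psiPair =
        Set.range (fun z : CharVar.Pairs g → ℂ => CharVar.Pchar + CharVar.psi z) := by
  refine ⟨⟨?_, ?_, ?_⟩, CharVar.hasOrder_psiPair hn, CharVar.pencilMembers_eq⟩
  · obtain ⟨z, hz⟩ := CharVar.Pchar_mem_range (g := g) (r := r) (n := n)
    rw [hz]
    exact CharVar.isQuasiPoisson_member z
  · rw [CharVar.pencilMembers_eq]
    rintro _ ⟨z, rfl⟩
    exact CharVar.isQuasiPoisson_member z
  · rw [CharVar.pencilMembers_eq]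
    rintro _ ⟨z, rfl⟩
    exact CharVar.isMomentMap_member z
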